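/- Let $d$ be a natural number. For $\phi:\mathbb Z^d\to\mathbb C$ finitely supported, let $\phi^{(1)}=\phi$ and $\phi^{(n)}=\phi^{(n-1)}*\phi$ for $n\ge 2$, where $(\phi*\psi)(x)=\sum_{y\in\mathbb Z^d}\phi(x-y)\psi(y)$, and let $\widehat\phi(\xi)=\sum_{x\in\mathbb Z^d}\phi(x)e^{ix\cdot\xi}$ for $\xi\in\mathbb R^d$. Put $\mathbb T^d=(-\pi,\pi]^d$ and $\Omega(\phi)=\{\xi\in\mathbb T^d:|\widehat\phi(\xi)|=1\}$. For a real- or complex-valued function $f$ on $\mathbb R^d$, let $\operatorname{Exp}(f)$ be the set of real $d\times d$ matrices $E$ with $t f(\xi)=f(t^E\xi)$ for all $t>0$ and $\xi\in\mathbb R^d$, where $t^E=\exp((\ln t)E)$. A complex polynomial $P$ in $d$ variables is called positive-homogeneous if $\operatorname{Exp}(P)\neq\varnothing$ and $R=\operatorname{Re}P$ satisfies $R(\xi)\ge 0$ for all $\xi\in\mathbb R^d$, with $R(\xi)=0$ only for $\xi=0$. Its homogeneous order is $\mu_P=\operatorname{tr}E$ for any $E\in\operatorname{Exp}(R)$ (the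 trace does not depend on $E$). The Legendre-Fenchel transform of $R$ is $R^{\#}(x)=\sup_{\xi\in\mathbb R^d}\{x\cdot\xi-R(\xi)\}$. A point $\xi_0\in\Omega(\phi)$ is of positive-homogeneous type for $\widehat\phi$, with drift $\alpha_{\xi_0}\in\mathbb R^d$ and positive-homogeneous polynomial $P_{\xi_0}$, if, for $\xi\in\mathbb R^d$ near $0$, $$\operatorname{Log}\frac{\widehat\phi(\xi+\xi_0)}{\widehat\phi(\xi_0)}=i\alpha_{\xi_0}\cdot\xi-P_{\xi_0}(\xi)+\Upsilon_{\xi_0}(\xi),\qquad \Upsilon_{\xi_0}(\xi)=o(\operatorname{Re}P_{\xi_0}(\xi))\ \text{ as }\xi\to 0,$$ where $\operatorname{Log}$ is the principal branch of the logarithm. Theorem. Let $\phi:\mathbb Z^d\to\mathbb C$ be finitely supported with $\sup_{\xi\in\mathbb T^d}|\widehat\phi(\xi)|=1$, and suppose that every $\xi\in\Omega(\phi)$ is of positive-homogeneous type for $\widehat\phi$, with drift $\alpha_\xi$ and polynomial $P_\xi$; put $R_\xi=\operatorname{Re}P_\xi$ and $\mu_\xi=\mu_{P_\xi}$. Then every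 $R_\xi^{\#}$ is finite on $\mathbb R^d$, the set $\Omega(\phi)=\{\xi_1,\dots,\xi_K\}$ is finite and, writing $\alpha_k=\alpha_{\xi_k}$, $R_k=R_{\xi_k}$, $\mu_k=\mu_{\xi_k}$, there are positive constants $C_1,\dots,C_K$ and $M_1,\dots,M_K$ such that $$|\phi^{(n)}(x)|\le\sum_{k=1}^K\frac{C_k}{n^{\mu_k}}\exp\left(-nM_kR_k^{\#}\left(\frac{x-n\alpha_k}{n}\right)\right)$$ for all integers $n\ge 1$ and all $x\in\mathbb Z^d$. -/

import Mathlib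

open scoped Matrix Topology

noncomputable section

namespace ConvPow

/-- Convolution of two complex-valued functions on `ℤ^d`. -/
def conv {d : ℕ} (φ ψ : (Fin d → ℤ) → ℂ) : (Fin d → ℤ) → ℂ :=
  fun x => ∑' y, φ (x - y) * ψ y

/-- Convolution powers: `φ^{(1)} = φ` and `φ^{(n)} = φ^{(n-1)} ∗ φ` for `n ≥ 2`
(by convention `φ^{(0)}` is the unit mass at `0`). -/
def convPow {d : ℕ} (φ : (Fin d → ℤ) → ℂ) : ℕ → (Fin d → ℤ) → ℂ
  | 0 => Pi.single 0 1
  | 1 => φ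
  | n + 2 => conv (convPow φ (n + 1)) φ

/-- The Fourier transform `φ̂(ξ) = ∑ₓ φ(x) e^{i x·ξ}`. -/
def fourier {d : ℕ} (φ : (Fin d → ℤ) → ℂ) (ξ : Fin d → ℝ) : ℂ :=
  ∑' x : Fin d → ℤ, φ x * Complex.exp (Complex.I * (((fun j => (x j : ℝ)) ⬝ᵥ ξ : ℝ) : ℂ))

/-- The torus `𝕋^d = (-π, π]^d`. -/
def torus (d : ℕ) : Set (Fin d → ℝ) :=
  Set.univ.pi fun _ => Set.Ioc (-Real.pi) Real.pi

/-- The normalization `sup_{ξ ∈ 𝕋^d} |φ̂(ξ)| = 1`. -/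
def IsNormalized {d : ℕ} (φ : (Fin d → ℤ) → ℂ) : Prop :=
  IsLUB ((fun ξ => ‖fourier φ ξ‖) '' torus d) 1

/-- `Ω(φ) = {ξ ∈ 𝕋^d : |φ̂(ξ)| = 1}`. -/
def Omega {d : ℕ} (φ : (Fin d → ℤ) → ℂ) : Set (Fin d → ℝ) :=
  {ξ | ξ ∈ torus d ∧ ‖fourier φ ξ‖ = 1}

/-- `Γ_{ξ₀}(ξ) = Log (φ̂(ξ + ξ₀) / φ̂(ξ₀))`, with the principal branch of the logarithm. -/
def Gam {d : ℕ} (φ : (Fin d → ℤ) → ℂ) (ξ₀ ξ : Fin d → ℝ) : ℂ :=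
  Complex.log (fourier φ (ξ + ξ₀) / fourier φ ξ₀)

/-- `t^E = exp ((ln t) E)` for a real matrix `E` (used for `t > 0`). -/
def matPow {d : ℕ} (t : ℝ) (E : Matrix (Fin d) (Fin d) ℝ) : Matrix (Fin d) (Fin d) ℝ :=
  NormedSpace.exp (Real.log t • E)

/-- The exponent set `Exp(f)` of a real- or complex-valued function on `ℝ^d`: the matrices `E`
with `t f(ξ) = f(t^E ξ)` for all `t > 0` and all `ξ`. -/
def exponentSet {d : ℕ} {V : Type*} [SMul ℝ V] (f : (Fin d → ℝ) → V) :
    Set (Matrix (Fin d) (Fin d) ℝ) :=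
  {E | ∀ t : ℝ, 0 < t → ∀ ξ : Fin d → ℝ, t • f ξ = f (matPow t E *ᵥ ξ)}

/-- The function on `ℝ^d` defined by a complex polynomial in `d` variables. -/
def polyFun {d : ℕ} (P : MvPolynomial (Fin d) ℂ) (ξ : Fin d → ℝ) : ℂ :=
  MvPolynomial.eval (fun j => (ξ j : ℂ)) P

/-- The real part `R = Re P` on `ℝ^d`. -/
def rePoly {d : ℕ} (P : MvPolynomial (Fin d) ℂ) (ξ : Fin d → ℝ) : ℝ :=
  (polyFun P ξ).re

/-- Positive-homogeneous polynomials: `Exp(P)` is nonempty and `R = Re P` is positive definite. -/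
def IsPositiveHomogeneous {d : ℕ} (P : MvPolynomial (Fin d) ℂ) : Prop :=
  (exponentSet (polyFun P)).Nonempty ∧ ∀ ξ, 0 ≤ rePoly P ξ ∧ (rePoly P ξ = 0 → ξ = 0)

/-- `μ` is the homogeneous order of `R`: `μ = tr E` for an exponent `E ∈ Exp(R)`. (For the real part
of a positive-homogeneous polynomial all exponents have the same trace.) -/
def IsHomogeneousOrder {d : ℕ} (R : (Fin d → ℝ) → ℝ) (μ : ℝ) : Prop :=
  ∃ E ∈ exponentSet R, μ = E.trace

/-- The Legendre-Fenchel transform `R^#(x) = sup_ξ (x·ξ - R(ξ))`. -/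
def legendreFenchel {d : ℕ} (R : (Fin d → ℝ) → ℝ) (x : Fin d → ℝ) : ℝ :=
  ⨆ ξ : Fin d → ℝ, (x ⬝ᵥ ξ - R ξ)

/-- `ξ₀` is of positive-homogeneous type for `φ̂`, with drift `α` and positive-homogeneous
polynomial `P`: `Γ_{ξ₀}(ξ) = i α·ξ - P(ξ) + Υ(ξ)` near `0`, where `Υ(ξ) = o(Re P(ξ))` as `ξ → 0` in
`ℝ^d`. -/
def IsPosHomType {d : ℕ} (φ : (Fin d → ℤ) → ℂ) (ξ₀ α : Fin d → ℝ)
    (P : MvPolynomial (Fin d) ℂ) : Prop :=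
  IsPositiveHomogeneous P ∧
    ∃ Υ : (Fin d → ℝ) → ℂ,
      (∀ᶠ ξ in 𝓝 (0 : Fin d → ℝ),
        Gam φ ξ₀ ξ = Complex.I * ((α ⬝ᵥ ξ : ℝ) : ℂ) - polyFun P ξ + Υ ξ) ∧
      Asymptotics.IsLittleO (𝓝 (0 : Fin d → ℝ)) Υ (rePoly P)

end ConvPow

end

/-! The number `φ^{(n)}(x)` is the `x`-th Fourier coefficient of `φ̂^n`. As `φ̂` is a trigonometric
polynomial, the integral may be moved from `ξ` to `ξ - iν` for any real `ν`, at the gain of a factor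
`exp (-x·ν)` (`coef_eq_shift`, `enorm_coef_le`). Near a point `a` of `Ω(φ)` the expansion on real
space extends to `|φ̂(a + ξ - iν)| ≤ exp (α·ν - R(ξ)/2 + M R(ν))` for small `ξ, ν`
(`IsPosHomType.norm_trigSum_le`): a Taylor polynomial replaces `φ̂`, and a polynomial on the complex
line `ξ + sν` is controlled by its values at `s = 0, 1, ..., D`, which are values on real space.

Integrating the `n`-th power over `ξ` and rescaling by `n^E`, of determinant `n^(tr E)`, yields
`n^(-μ) exp (n (α·ν + M R(ν)))`. With `y = (x - nα)/n`, optimising `y·ν - M R(ν)` over small `ν`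
yields a multiple of `R^#(y)`. Small `ν` suffice because `y` is bounded on the support of `φ^{(n)}`
and `R(λξ) ≤ A λ² R(ξ)` for `0 ≤ λ ≤ 1` (`exists_le_small_of_legendre`).

Different points of `Ω(φ)` need different shifts `ν`, and a smooth cutoff would not survive a
contour shift. So `φ̂^n` is split as `∑ W_a φ̂^n` with weights `W_a` that are themselves
trigonometric polynomials (`exists_weights`), built with parameter `m = ⌊n/L⌋`. The weight `W_a` is
bounded near `a`, is `O(2^(-m))` near the other points of `Ω(φ)`, and is at most `A B^m` elsewhere;
for large `L` that growth is beaten by the decay of `φ̂^n` away from `Ω(φ)`. -/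

noncomputable section

namespace ConvPow

/-! ### Determinants of matrix exponentials -/

section MatrixExp

attribute [local instance] Matrix.linftyOpNormedRing Matrix.linftyOpNormedAlgebra

/-- The curves `exp (tE)` and `1 + tE` have the same velocity at `t = 0`, hence so do their
determinants, and the second determinant is a polynomial in `t` with linear coefficient `tr E`. -/
theorem hasDerivAt_det_exp_zero {d : ℕ} (E : Matrix (Fin d) (Fin d) ℝ) :
    HasDerivAt (fun t : ℝ => (NormedSpace.exp (t • E)).det) E.trace 0 := by
  have hdet : DifferentiableAt ℝ (fun A : Matrix (Fin d) (Fin d) ℝ => A.det) 1 := by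
    simp only [Matrix.det_apply]
    have hent : ∀ i j, Differentiable ℝ (fun A : Matrix (Fin d) (Fin d) ℝ => A i j) := by
      intro i j
      exact (LinearMap.toContinuousLinearMap
        (Matrix.entryLinearMap ℝ ℝ i j : Matrix (Fin d) (Fin d) ℝ →ₗ[ℝ] ℝ)).differentiable
    refine DifferentiableAt.fun_sum fun σ _ => DifferentiableAt.const_smul ?_ _
    exact (HasFDerivAt.finsetProd fun i _ =>
      (hent (σ i) i).differentiableAt.hasFDerivAt).differentiableAt
  have h1 : HasDerivAt (fun t : ℝ => NormedSpace.exp (t • E)) E 0 := by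
    have h := hasDerivAt_exp_smul_const (𝕂 := ℝ) E (0 : ℝ)
    simp only [zero_smul, NormedSpace.exp_zero, one_mul] at h
    exact h
  have h2 : HasDerivAt (fun t : ℝ => (1 : Matrix (Fin d) (Fin d) ℝ) + t • E) E 0 := by
    have h := ((hasDerivAt_id (0 : ℝ)).smul_const E).const_add 1
    simp only [one_smul] at h
    exact h
  have hd1 := HasFDerivAt.comp_hasDerivAt_of_eq (0 : ℝ) hdet.hasFDerivAt h1 (by simp)
  have hd2 := HasFDerivAt.comp_hasDerivAt_of_eq (0 : ℝ) hdet.hasFDerivAt h2 (by simp)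
  have hd3 : HasDerivAt (fun t : ℝ => ((1 : Matrix (Fin d) (Fin d) ℝ) + t • E).det) E.trace 0 := by
    have : (fun t : ℝ => ((1 : Matrix (Fin d) (Fin d) ℝ) + t • E).det) = fun t =>
        ((1 : Matrix (Fin d) (Fin d) (Polynomial ℝ)) +
          (Polynomial.X : Polynomial ℝ) • E.map Polynomial.C).det.eval t := by
      ext t
      rw [← Polynomial.coe_evalRingHom, RingHom.map_det]
      congr 1
      ext i j
      by_cases h : i = j <;> simp [h, mul_comm t]
    rw [this]
    have := (((1 : Matrix (Fin d) (Fin d) (Polynomial ℝ)) +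
          (Polynomial.X : Polynomial ℝ) • E.map Polynomial.C).det).hasDerivAt 0
    rwa [Matrix.derivative_det_one_add_X_smul] at this
  have := hd2.unique hd3
  rw [← this]
  exact hd1

/-- The determinant is multiplicative in `t`, so its derivative at `0` determines its derivative
everywhere, and the product with `exp (-t tr E)` is constant. -/
theorem det_exp_smul {d : ℕ} (E : Matrix (Fin d) (Fin d) ℝ) (t : ℝ) :
    (NormedSpace.exp (t • E)).det = Real.exp (t * E.trace) := by
  set f : ℝ → ℝ := fun t => (NormedSpace.exp (t • E)).det with hf
  have hadd : ∀ s t, f (s + t) = f s * f t := by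
    intro s t
    simp only [hf]
    rw [add_smul, Matrix.exp_add_of_commute _ _ (((Commute.refl E).smul_left s).smul_right t),
      Matrix.det_mul]
  have hder : ∀ s, HasDerivAt f (f s * E.trace) s := by
    intro s
    have h0 : HasDerivAt f E.trace (s - s) := by
      rw [sub_self]; exact hasDerivAt_det_exp_zero E
    have h1 : HasDerivAt (fun u => f s * f (u - s)) (f s * E.trace) s :=
      (h0.comp_sub_const s s).const_mul (f s)
    refine h1.congr_of_eventuallyEq (Filter.Eventually.of_forall fun u => ?_)
    change f u = f s * f (u - s)
    rw [← hadd]; congr 1; ring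
  have hconst : ∀ s, HasDerivAt (fun u => f u * Real.exp (-(u * E.trace))) 0 s := by
    intro s
    have h2 : HasDerivAt (fun u : ℝ => Real.exp (-(u * E.trace)))
        (Real.exp (-(s * E.trace)) * (-(1 * E.trace))) s :=
      (((hasDerivAt_id s).mul_const E.trace).neg).exp
    have h3 := (hder s).mul h2
    have h4 : f s * E.trace * Real.exp (-(s * E.trace)) +
        f s * (Real.exp (-(s * E.trace)) * (-(1 * E.trace))) = 0 := by ring
    rw [h4] at h3
    exact h3
  have := is_const_of_deriv_eq_zero (fun s => (hconst s).differentiableAt)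
    (fun s => (hconst s).deriv) t 0
  have h00 : f 0 = 1 := by simp [hf]
  simp only [h00, zero_mul, neg_zero, Real.exp_zero, mul_one] at this
  change f t = _
  rw [Real.exp_neg] at this
  field_simp at this
  exact this

end MatrixExp

/-! ### The dilations `t^E`. -/

theorem matPow_one {d : ℕ} (E : Matrix (Fin d) (Fin d) ℝ) : matPow 1 E = 1 := by
  simp [matPow]

theorem matPow_mul_matPow_inv {d : ℕ} {t : ℝ} (E : Matrix (Fin d) (Fin d) ℝ) :
    matPow t E * matPow t⁻¹ E = 1 := by
  unfold matPow
  rw [← Matrix.exp_add_of_commute _ _ (((Commute.refl E).smul_left _).smul_right _), Real.log_inv]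
  simp

theorem matPow_mulVec_inv {d : ℕ} {t : ℝ} (E : Matrix (Fin d) (Fin d) ℝ) (ξ : Fin d → ℝ) :
    matPow t E *ᵥ (matPow t⁻¹ E *ᵥ ξ) = ξ := by
  rw [Matrix.mulVec_mulVec, matPow_mul_matPow_inv, Matrix.one_mulVec]

theorem det_matPow {d : ℕ} {t : ℝ} (ht : 0 < t) (E : Matrix (Fin d) (Fin d) ℝ) :
    (matPow t E).det = t ^ E.trace := by
  rw [matPow, det_exp_smul, Real.rpow_def_of_pos ht]

theorem continuousOn_matPow_mulVec {d : ℕ} (E : Matrix (Fin d) (Fin d) ℝ) (ξ : Fin d → ℝ) :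
    ContinuousOn (fun t : ℝ => matPow t E *ᵥ ξ) (Set.Ioi 0) := by
  let _ := Matrix.linftyOpNormedRing (n := Fin d) (α := ℝ)
  let _ := Matrix.linftyOpNormedAlgebra (n := Fin d) (R := ℝ) (α := ℝ)
  let _ := NormedAlgebra.restrictScalars ℚ ℝ (Matrix (Fin d) (Fin d) ℝ)
  have h : ContinuousOn (fun t : ℝ => matPow t E) (Set.Ioi 0) := by
    unfold matPow
    refine (NormedSpace.exp_continuous).comp_continuousOn ?_
    have hlog : ContinuousOn Real.log (Set.Ioi 0) :=
      Real.continuousOn_log.mono fun t ht => ne_of_gt ht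
    exact hlog.smul continuousOn_const
  exact ((Continuous.matrix_mulVec continuous_id continuous_const).comp_continuousOn h)

/-! ### Polynomials along lines -/

/-- The coefficients of a polynomial of bounded degree are bounded by its values at the first
natural numbers. -/
theorem exists_coeff_bound (D : ℕ) :
    ∃ K : ℝ, 0 ≤ K ∧ ∀ g : Polynomial ℂ, g.natDegree ≤ D → ∀ j,
      ‖g.coeff j‖ ≤ K * ∑ i ∈ Finset.range (D + 1), ‖g.eval (i : ℂ)‖ := by
  set b : ℕ → Polynomial ℂ := Lagrange.basis (Finset.range (D + 1)) (fun i : ℕ => (i : ℂ)) with hb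
  refine ⟨∑ i ∈ Finset.range (D + 1), ∑ j ∈ Finset.range (D + 1), ‖(b i).coeff j‖,
    by positivity, fun g hg j => ?_⟩
  by_cases hj : D < j
  · rw [Polynomial.coeff_eq_zero_of_natDegree_lt (hg.trans_lt hj), norm_zero]
    positivity
  have hg2 : g = ∑ i ∈ Finset.range (D + 1), Polynomial.C (g.eval (i : ℂ)) * b i := by
    have := Lagrange.eq_interpolate (s := Finset.range (D + 1)) (v := fun i : ℕ => (i : ℂ)) (f := g)
      (fun a _ b _ h => by simpa using h) (by
        rw [Finset.card_range]
        exact (Polynomial.degree_le_of_natDegree_le hg).trans_lt (by exact_mod_cast Nat.lt_succ_self D))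
    rwa [Lagrange.interpolate_apply] at this
  conv_lhs => rw [hg2]
  rw [Polynomial.finsetSum_coeff, Finset.sum_mul]
  refine (norm_sum_le _ _).trans (Finset.sum_le_sum fun i hi => ?_)
  rw [Polynomial.coeff_C_mul, norm_mul, mul_comm]
  gcongr
  · exact Finset.single_le_sum (f := fun j => ‖(b i).coeff j‖) (fun _ _ => norm_nonneg _)
      (Finset.mem_range.2 (by omega))
  · exact Finset.single_le_sum (f := fun i : ℕ => ‖g.eval (i : ℂ)‖) (fun _ _ => norm_nonneg _) hi

/-- The restriction of a polynomial to the line `s ↦ a + s b`. -/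
def linePoly {d : ℕ} (P : MvPolynomial (Fin d) ℂ) (a b : Fin d → ℂ) : Polynomial ℂ :=
  MvPolynomial.aeval (fun j => Polynomial.C (a j) + Polynomial.C (b j) * Polynomial.X) P

theorem eval_linePoly {d : ℕ} (P : MvPolynomial (Fin d) ℂ) (a b : Fin d → ℂ) (s : ℂ) :
    (linePoly P a b).eval s = MvPolynomial.eval (fun j => a j + b j * s) P := by
  unfold linePoly
  rw [← Polynomial.coe_evalRingHom, MvPolynomial.aeval_def, MvPolynomial.hom_eval₂,
    MvPolynomial.eval]
  congr 1
  · ext x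
    simp
  · ext j; simp

theorem natDegree_linePoly_le {d : ℕ} (P : MvPolynomial (Fin d) ℂ) (a b : Fin d → ℂ) :
    (linePoly P a b).natDegree ≤ P.totalDegree := by
  have := MvPolynomial.aeval_natDegree_le P le_rfl
    (fun j => Polynomial.C (a j) + Polynomial.C (b j) * Polynomial.X) (n := 1) (fun j => by
      compute_degree)
  rwa [mul_one] at this

theorem eval_linePoly_eq_sum {d : ℕ} (P : MvPolynomial (Fin d) ℂ) (a b : Fin d → ℂ) (s : ℂ) :
    (linePoly P a b).eval s =
      ∑ j ∈ Finset.range (P.totalDegree + 1), (linePoly P a b).coeff j * s ^ j :=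
  Polynomial.eval_eq_sum_range' (Nat.lt_succ_of_le (natDegree_linePoly_le P a b)) s

/-! ### Positive definite homogeneous functions -/

theorem homogeneous_zero {d : ℕ} {R : (Fin d → ℝ) → ℝ} {E : Matrix (Fin d) (Fin d) ℝ}
    (hE : E ∈ exponentSet R) : R 0 = 0 := by
  have := hE 2 (by norm_num) 0
  rw [Matrix.mulVec_zero, smul_eq_mul] at this
  linarith

theorem exists_pos_le_on_sphere {d : ℕ} {R : (Fin d → ℝ) → ℝ} (hc : Continuous R)
    (hpos : ∀ ξ, 0 ≤ R ξ ∧ (R ξ = 0 → ξ = 0)) :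
    ∃ c : ℝ, 0 < c ∧ ∀ ξ, ‖ξ‖ = 1 → c ≤ R ξ := by
  -- The sphere is empty when `d = 0`.
  rcases (Metric.sphere (0 : Fin d → ℝ) 1).eq_empty_or_nonempty with h | h
  · refine ⟨1, one_pos, fun ξ hξ => ?_⟩
    have : ξ ∈ Metric.sphere (0 : Fin d → ℝ) 1 := by simpa using hξ
    simp [h] at this
  · obtain ⟨ξ₀, h0, hmin⟩ := (isCompact_sphere (0 : Fin d → ℝ) 1).exists_isMinOn h hc.continuousOn
    refine ⟨R ξ₀, lt_of_le_of_ne (hpos ξ₀).1 fun h => ?_, fun ξ hξ => hmin (by simpa using hξ)⟩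
    have := (hpos ξ₀).2 h.symm
    simp [this] at h0

/-- A positive definite homogeneous function is small only inside the unit ball. -/
theorem norm_lt_one_of_lt {d : ℕ} {R : (Fin d → ℝ) → ℝ} (hc : Continuous R)
    {E : Matrix (Fin d) (Fin d) ℝ} (hE : E ∈ exponentSet R) {c : ℝ} (hcpos : 0 < c)
    (hR0 : ∀ ξ, 0 ≤ R ξ)
    (hsph : ∀ ξ, ‖ξ‖ = 1 → c ≤ R ξ) {ξ : Fin d → ℝ} (hξ : R ξ < c) : ‖ξ‖ < 1 := by
  by_contra! hge
  -- Along the orbit `s^E ξ` with `s ≤ 1` the value `s R(ξ)` stays below `c`, so the orbit of a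
  -- point outside the unit ball never crosses the unit sphere.
  have hpath : ∀ t : ℝ, 0 < t → t ≤ 1 → 1 ≤ ‖matPow t E *ᵥ ξ‖ := by
    intro t ht ht1
    by_contra! hlt
    have hcont : ContinuousOn (fun s : ℝ => ‖matPow s E *ᵥ ξ‖) (Set.Icc t 1) :=
      ((continuousOn_matPow_mulVec E ξ).mono fun s hs => lt_of_lt_of_le ht hs.1).norm
    obtain ⟨s, hs, hs1⟩ := intermediate_value_Icc ht1 hcont
      (show (1 : ℝ) ∈ Set.Icc _ _ from ⟨hlt.le, by simpa [matPow_one] using hge⟩)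
    have h1 := hsph _ hs1
    have hs0 : 0 < s := lt_of_lt_of_le ht hs.1
    rw [← hE s hs0 ξ, smul_eq_mul] at h1
    nlinarith [hs.2, hR0 ξ]
  obtain ⟨B, hB⟩ := (isCompact_Icc (a := (0 : ℝ)) (b := 1)).bddAbove_image
    (f := fun s : ℝ => R (s • ξ)) (by fun_prop)
  have hB' : ∀ s ∈ Set.Icc (0 : ℝ) 1, R (s • ξ) ≤ B := fun s hs => hB ⟨s, hs, rfl⟩
  have hB0 : 0 ≤ B := (hR0 _).trans (hB' 0 (by simp))
  -- This `t` makes `t R ≤ c/2` on the whole segment `[0, ξ]`. Its image under `t^E` joins `0` to a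
  -- point of norm at least one, so it meets the sphere, where `R ≥ c`.
  set t : ℝ := min 1 (c / (2 * (B + 1))) with ht
  have htpos : 0 < t := by positivity
  have hcont : ContinuousOn (fun s : ℝ => ‖matPow t E *ᵥ (s • ξ)‖) (Set.Icc 0 1) := by
    refine Continuous.continuousOn ?_
    exact (Continuous.matrix_mulVec continuous_const (by fun_prop)).norm
  obtain ⟨s, hs, hs1⟩ := intermediate_value_Icc (zero_le_one' ℝ) hcont
    (show (1 : ℝ) ∈ Set.Icc _ _ from ⟨by simp, by
      simpa using hpath t htpos (min_le_left _ _)⟩)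
  have h1 := hsph _ hs1
  rw [← hE t htpos, smul_eq_mul] at h1
  have h2 : t * R (s • ξ) ≤ c / (2 * (B + 1)) * (B + 1) :=
    mul_le_mul (min_le_right _ _) ((hB' s hs).trans (by linarith)) (hR0 _) (by positivity)
  have h3 : c / (2 * (B + 1)) * (B + 1) = c / 2 := by field_simp
  linarith

/-- Sublevel sets of positive definite homogeneous functions are bounded. -/
theorem exists_norm_le_of_le {d : ℕ} {R : (Fin d → ℝ) → ℝ} (hc : Continuous R)
    {E : Matrix (Fin d) (Fin d) ℝ} (hE : E ∈ exponentSet R)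
    (hpos : ∀ ξ, 0 ≤ R ξ ∧ (R ξ = 0 → ξ = 0)) (L : ℝ) :
    ∃ r : ℝ, 0 < r ∧ ∀ ξ, R ξ ≤ L → ‖ξ‖ ≤ r := by
  obtain ⟨c, hc0, hsph⟩ := exists_pos_le_on_sphere hc hpos
  set t : ℝ := c / (2 * (|L| + 1)) with ht
  have htpos : 0 < t := by positivity
  obtain ⟨r, hr⟩ := (isCompact_closedBall (0 : Fin d → ℝ) 1).bddAbove_image
    (f := fun ξ => ‖matPow t⁻¹ E *ᵥ ξ‖)
    (Continuous.matrix_mulVec continuous_const continuous_id).norm.continuousOn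
  refine ⟨max r 1, by positivity, fun ξ hξ => le_max_of_le_left ?_⟩
  have h1 : ‖matPow t E *ᵥ ξ‖ < 1 := by
    refine norm_lt_one_of_lt hc hE hc0 (fun ξ => (hpos ξ).1) hsph ?_
    rw [← hE t htpos, smul_eq_mul]
    have h2 : t * R ξ ≤ t * (|L| + 1) := by
      gcongr
      linarith [le_abs_self L]
    have h3 : t * (|L| + 1) = c / 2 := by rw [ht]; field_simp
    linarith
  have := hr ⟨matPow t E *ᵥ ξ, by simpa using h1.le, rfl⟩
  have h4 := matPow_mulVec_inv (t := t⁻¹) E ξ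
  rw [inv_inv] at h4
  simpa [h4] using this

/-- A bound on the bounded set `R ξ ≤ 1`, `R η ≤ 1` extends by homogeneity. -/
theorem exists_le_mul_add_of_homogeneous {d : ℕ} {R : (Fin d → ℝ) → ℝ} (hc : Continuous R)
    {E : Matrix (Fin d) (Fin d) ℝ} (hE : E ∈ exponentSet R)
    (hpos : ∀ ξ, 0 ≤ R ξ ∧ (R ξ = 0 → ξ = 0))
    {F : (Fin d → ℝ) × (Fin d → ℝ) → ℝ} (hF : Continuous F)
    (hhom : ∀ t : ℝ, 0 < t → ∀ ξ η, F (matPow t E *ᵥ ξ, matPow t E *ᵥ η) = t * F (ξ, η)) :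
    ∃ C : ℝ, 0 < C ∧ ∀ ξ η, F (ξ, η) ≤ C * (R ξ + R η) := by
  obtain ⟨r, hr0, hr⟩ := exists_norm_le_of_le hc hE hpos 1
  obtain ⟨C, hC⟩ := (isCompact_closedBall (0 : (Fin d → ℝ) × (Fin d → ℝ)) r).bddAbove_image
    hF.continuousOn
  refine ⟨max C 1, by positivity, fun ξ η => ?_⟩
  have h1 := (hpos ξ).1
  have h2 := (hpos η).1
  rcases (add_nonneg h1 h2).eq_or_lt with h | h
  · have hξ : ξ = 0 := (hpos ξ).2 (by linarith)
    have hη : η = 0 := (hpos η).2 (by linarith)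
    have h0 := hhom 2 (by norm_num) 0 0
    rw [Matrix.mulVec_zero] at h0
    rw [← h, hξ, hη]
    linarith
  · set t := R ξ + R η
    have ht : 0 < t⁻¹ := inv_pos.2 h
    have hb : ∀ ζ, R ζ ≤ t → ‖matPow t⁻¹ E *ᵥ ζ‖ ≤ r := by
      intro ζ hζ
      apply hr
      rw [← hE _ ht, smul_eq_mul, inv_mul_le_iff₀ h]
      linarith
    have h3 : F (matPow t⁻¹ E *ᵥ ξ, matPow t⁻¹ E *ᵥ η) ≤ C := hC ⟨_, by
      rw [mem_closedBall_zero_iff, Prod.norm_def]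
      exact max_le (hb ξ (by simp only [t]; linarith)) (hb η (by simp only [t]; linarith)), rfl⟩
    rw [hhom _ ht, inv_mul_le_iff₀ h] at h3
    calc F (ξ, η) ≤ t * C := h3
      _ ≤ max C 1 * t := by rw [mul_comm]; gcongr; exact le_max_left _ _

/-! ### Positive-homogeneous polynomials -/

theorem continuous_polyFun {d : ℕ} (P : MvPolynomial (Fin d) ℂ) : Continuous (polyFun P) := by
  unfold polyFun
  exact (MvPolynomial.continuous_eval P).comp (by fun_prop)

theorem continuous_rePoly {d : ℕ} (P : MvPolynomial (Fin d) ℂ) : Continuous (rePoly P) :=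
  Complex.continuous_re.comp (continuous_polyFun P)

theorem exponentSet_polyFun_subset {d : ℕ} (P : MvPolynomial (Fin d) ℂ) :
    exponentSet (polyFun P) ⊆ exponentSet (rePoly P) := by
  intro E hE t ht ξ
  have := congrArg Complex.re (hE t ht ξ)
  simpa [rePoly] using this

namespace IsPositiveHomogeneous

variable {d : ℕ} {P : MvPolynomial (Fin d) ℂ}

theorem nonneg (hP : IsPositiveHomogeneous P) (ξ : Fin d → ℝ) : 0 ≤ rePoly P ξ := (hP.2 ξ).1

/-- An exponent of `P` itself, not only of `R`, makes `|P|` and `R` scale alike, so the imaginary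
part of `P` is controlled too. -/
theorem norm_polyFun_le (hP : IsPositiveHomogeneous P) :
    ∃ C : ℝ, 0 < C ∧ ∀ ξ, ‖polyFun P ξ‖ ≤ C * rePoly P ξ := by
  obtain ⟨E, hE⟩ := hP.1
  have hE' := exponentSet_polyFun_subset P hE
  obtain ⟨C, hC, h⟩ := exists_le_mul_add_of_homogeneous (continuous_rePoly P) hE' hP.2
    (F := fun p => ‖polyFun P p.1‖) (((continuous_polyFun P).comp continuous_fst).norm) (by
      intro t ht ξ η
      rw [← hE t ht ξ, norm_smul, Real.norm_of_nonneg ht.le])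
  refine ⟨C, hC, fun ξ => ?_⟩
  simpa [homogeneous_zero hE'] using h ξ 0

/-- A quasi-triangle inequality: both sides scale alike under the simultaneous dilation of `ξ` and
`η`. -/
theorem add_le (hP : IsPositiveHomogeneous P) :
    ∃ C : ℝ, 1 ≤ C ∧ ∀ ξ η, rePoly P (ξ + η) ≤ C * (rePoly P ξ + rePoly P η) := by
  obtain ⟨E, hE⟩ := hP.1
  have hE' := exponentSet_polyFun_subset P hE
  obtain ⟨C, hC, h⟩ := exists_le_mul_add_of_homogeneous (continuous_rePoly P) hE' hP.2
    (F := fun p => rePoly P (p.1 + p.2))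
    ((continuous_rePoly P).comp (continuous_fst.add continuous_snd)) (by
      intro t ht ξ η
      simp only
      rw [← Matrix.mulVec_add, ← hE' t ht, smul_eq_mul])
  refine ⟨max C 1, le_max_right _ _, fun ξ η => (h ξ η).trans ?_⟩
  gcongr
  · exact add_nonneg (hP.nonneg _) (hP.nonneg _)
  · exact le_max_left _ _

/-- The points `ξ + iη` are the interpolation nodes at which restrictions of polynomials to lines
are controlled. -/
theorem add_nsmul_le (hP : IsPositiveHomogeneous P) (N : ℕ) :
    ∃ C : ℝ, 1 ≤ C ∧ ∀ i ≤ N, ∀ ξ η,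
      rePoly P (ξ + (i : ℝ) • η) ≤ C * (rePoly P ξ + rePoly P η) := by
  obtain ⟨A, hA, h⟩ := hP.add_le
  induction N with
  | zero =>
    refine ⟨1, le_rfl, fun i hi ξ η => ?_⟩
    obtain rfl : i = 0 := by omega
    simpa using hP.nonneg η
  | succ N ih =>
    obtain ⟨C, hC, hi⟩ := ih
    have key : ∀ ξ η : Fin d → ℝ, C * (rePoly P ξ + rePoly P η) ≤
        A * (C + 1) * (rePoly P ξ + rePoly P η) := by
      intro ξ η
      have := add_nonneg (hP.nonneg ξ) (hP.nonneg η)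
      gcongr
      nlinarith
    refine ⟨A * (C + 1), by nlinarith, fun i hiN ξ η => ?_⟩
    rcases Nat.lt_or_ge i (N + 1) with hlt | hge
    · exact (hi i (by omega) ξ η).trans (key ξ η)
    · obtain rfl : i = N + 1 := by omega
      have e : ξ + ((N + 1 : ℕ) : ℝ) • η = (ξ + (N : ℝ) • η) + η := by
        push_cast; rw [add_smul, one_smul, add_assoc]
      rw [e]
      refine (h _ _).trans ?_
      have h1 := hi N le_rfl ξ η
      have h2 := hP.nonneg ξ
      have h3 := hP.nonneg η
      rw [mul_assoc]
      gcongr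
      nlinarith

/-- The coefficients of the restriction of `P` to a real line are controlled by `Re P`. -/
theorem norm_coeff_linePoly_le (hP : IsPositiveHomogeneous P) :
    ∃ C : ℝ, 0 < C ∧ ∀ (ξ η : Fin d → ℝ) (j : ℕ),
      ‖(linePoly P (fun k => (ξ k : ℂ)) (fun k => (η k : ℂ))).coeff j‖ ≤
        C * (rePoly P ξ + rePoly P η) := by
  obtain ⟨K, hK, hcoef⟩ := exists_coeff_bound P.totalDegree
  obtain ⟨A, hA, hPA⟩ := hP.norm_polyFun_le
  obtain ⟨B, hB, hadd⟩ := hP.add_nsmul_le P.totalDegree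
  refine ⟨K * ((P.totalDegree + 1) * (A * B)) + 1, by positivity, fun ξ η j => ?_⟩
  have hn := add_nonneg (hP.nonneg ξ) (hP.nonneg η)
  refine (hcoef _ (natDegree_linePoly_le _ _ _) j).trans ?_
  have : ∑ i ∈ Finset.range (P.totalDegree + 1),
      ‖(linePoly P (fun k => (ξ k : ℂ)) (fun k => (η k : ℂ))).eval (i : ℂ)‖ ≤
      ∑ _i ∈ Finset.range (P.totalDegree + 1), A * (B * (rePoly P ξ + rePoly P η)) := by
    refine Finset.sum_le_sum fun i hi => ?_
    rw [eval_linePoly]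
    have e : MvPolynomial.eval (fun j => (ξ j : ℂ) + (η j : ℂ) * (i : ℂ)) P =
        polyFun P (ξ + (i : ℝ) • η) := by
      unfold polyFun
      congr 2
      ext k
      simp [mul_comm]
    rw [e]
    refine (hPA _).trans ?_
    gcongr
    exact hadd i (by simpa [Nat.lt_succ_iff] using hi) ξ η
  calc _ ≤ K * _ := mul_le_mul_of_nonneg_left this hK
    _ = K * ((P.totalDegree + 1) * (A * B)) * (rePoly P ξ + rePoly P η) := by
      simp; ring
    _ ≤ _ := by gcongr; linarith

theorem polyFun_smul (P : MvPolynomial (Fin d) ℂ) (ξ : Fin d → ℝ) (s : ℝ) :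
    polyFun P (s • ξ) = ∑ j ∈ Finset.range (P.totalDegree + 1),
      (linePoly P (fun _ => 0) (fun k => (ξ k : ℂ))).coeff j * (s : ℂ) ^ j := by
  rw [← eval_linePoly_eq_sum, eval_linePoly]
  unfold polyFun
  congr 2
  ext k
  simp [mul_comm]

theorem rePoly_zero (hP : IsPositiveHomogeneous P) : rePoly P 0 = 0 := by
  obtain ⟨E, hE⟩ := hP.1
  exact homogeneous_zero (exponentSet_polyFun_subset P hE)

theorem polyFun_zero (hP : IsPositiveHomogeneous P) : polyFun P 0 = 0 := by
  obtain ⟨C, -, h⟩ := hP.norm_polyFun_le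
  simpa [hP.rePoly_zero] using h 0

/-- Dilating by a factor at least one increases `Re P` at most polynomially. -/
theorem rePoly_smul_le_pow (hP : IsPositiveHomogeneous P) :
    ∃ C : ℝ, 1 ≤ C ∧ ∀ (s : ℝ) (ξ : Fin d → ℝ), 1 ≤ s →
      rePoly P (s • ξ) ≤ C * s ^ P.totalDegree * rePoly P ξ := by
  obtain ⟨C, hC, h⟩ := hP.norm_coeff_linePoly_le
  refine ⟨(P.totalDegree + 1) * C + 1, by nlinarith [show (0:ℝ) ≤ P.totalDegree by positivity],
    fun s ξ hs => ?_⟩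
  have h1 : rePoly P (s • ξ) ≤ ∑ j ∈ Finset.range (P.totalDegree + 1),
      C * rePoly P ξ * s ^ P.totalDegree := by
    refine (Complex.re_le_norm _).trans ?_
    rw [polyFun_smul]
    refine (norm_sum_le _ _).trans (Finset.sum_le_sum fun j hj => ?_)
    rw [norm_mul, norm_pow, Complex.norm_real, Real.norm_of_nonneg (by linarith)]
    have := h 0 ξ j
    rw [hP.rePoly_zero, zero_add] at this
    have e : (fun k : Fin d => (((0 : Fin d → ℝ) k : ℝ) : ℂ)) = fun _ => 0 := by ext; simp
    rw [e] at this
    have hn := hP.nonneg ξ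
    gcongr
    simpa [Nat.lt_succ_iff] using hj
  refine h1.trans ?_
  have hn := hP.nonneg ξ
  have : 0 ≤ s ^ P.totalDegree * rePoly P ξ := by positivity
  simp
  nlinarith

/-- Contracting by a factor `s ≤ 1` decreases `Re P` at least quadratically. -/
theorem rePoly_smul_le_sq (hP : IsPositiveHomogeneous P) :
    ∃ C : ℝ, 1 ≤ C ∧ ∀ (s : ℝ) (ξ : Fin d → ℝ), 0 ≤ s → s ≤ 1 →
      rePoly P (s • ξ) ≤ C * s ^ 2 * rePoly P ξ := by
  obtain ⟨C, hC, h⟩ := hP.norm_coeff_linePoly_le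
  refine ⟨(P.totalDegree + 1) * (2 * C) + 1,
    by nlinarith [show (0:ℝ) ≤ P.totalDegree by positivity], fun s ξ hs hs1 => ?_⟩
  set a : ℕ → ℂ := fun j => (linePoly P (fun _ => 0) (fun k => (ξ k : ℂ))).coeff j with ha
  have hab : ∀ j, ‖a j‖ ≤ C * rePoly P ξ := by
    intro j
    have := h 0 ξ j
    rw [hP.rePoly_zero, zero_add] at this
    have e : (fun k : Fin d => (((0 : Fin d → ℝ) k : ℝ) : ℂ)) = fun _ => 0 := by ext; simp
    rwa [e] at this
  have hn := hP.nonneg ξ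
  have ha0 : a 0 = 0 := by
    have := polyFun_smul P ξ 0
    rw [zero_smul, hP.polyFun_zero, Finset.sum_range_succ'] at this
    simpa using this.symm
  have h1 : rePoly P (s • ξ) ≤ ∑ j ∈ Finset.range (P.totalDegree + 1),
      2 * C * rePoly P ξ * s ^ 2 := by
    -- As `R(-sξ) ≥ 0`, symmetrising only increases the left side, and it cancels the odd powers of
    -- `s`, in particular the linear one. The constant term is already zero.
    have h2 : rePoly P (s • ξ) ≤ (polyFun P (s • ξ) + polyFun P ((-s) • ξ)).re := by
      have := hP.nonneg ((-s) • ξ)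
      rw [Complex.add_re]
      change 0 ≤ (polyFun P ((-s) • ξ)).re at this
      change (polyFun P (s • ξ)).re ≤ _
      linarith
    refine h2.trans ((Complex.re_le_norm _).trans ?_)
    rw [polyFun_smul, polyFun_smul, ← Finset.sum_add_distrib]
    refine (norm_sum_le _ _).trans (Finset.sum_le_sum fun j hj => ?_)
    change ‖a j * (s : ℂ) ^ j + a j * ((-s : ℝ) : ℂ) ^ j‖ ≤ _
    have hnn : 0 ≤ 2 * C * rePoly P ξ * s ^ 2 := by positivity
    match j with
    | 0 => simpa [ha0] using hnn
    | 1 => simpa using hnn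
    | j + 2 =>
      refine (norm_add_le _ _).trans ?_
      have e : ‖((-s : ℝ) : ℂ)‖ = s := by rw [Complex.norm_real, norm_neg, Real.norm_of_nonneg hs]
      rw [norm_mul, norm_mul, norm_pow, norm_pow, e, Complex.norm_real, Real.norm_of_nonneg hs]
      have h3 : s ^ (j + 2) ≤ s ^ 2 := pow_le_pow_of_le_one hs hs1 (by omega)
      have h4 : ‖a (j + 2)‖ * s ^ (j + 2) ≤ C * rePoly P ξ * s ^ 2 := by
        gcongr; exact hab _
      linarith
  refine h1.trans ?_
  have : 0 ≤ s ^ 2 * rePoly P ξ := by positivity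
  simp
  nlinarith

/-- Dilating `ξ` to the unit sphere gives `‖ξ‖^D ≤ C R(ξ)` for `D` the total degree. The extra power
of `‖ξ‖` makes Taylor remainders of order `D + 1` negligible against `R`. -/
theorem pow_norm_le (hP : IsPositiveHomogeneous P) :
    ∃ C : ℝ, 0 < C ∧ ∀ ξ : Fin d → ℝ, ‖ξ‖ ≤ 1 → ‖ξ‖ ^ (P.totalDegree + 1) ≤ C * ‖ξ‖ * rePoly P ξ := by
  obtain ⟨c, hc, hsph⟩ := exists_pos_le_on_sphere (continuous_rePoly P) hP.2
  obtain ⟨A, hA, h⟩ := hP.rePoly_smul_le_pow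
  refine ⟨A / c, by positivity, fun ξ hξ => ?_⟩
  rcases eq_or_ne ξ 0 with rfl | h0
  · simp
  have hn : 0 < ‖ξ‖ := norm_pos_iff.2 h0
  have h1 := hsph (‖ξ‖⁻¹ • ξ) (by rw [norm_smul, norm_inv, norm_norm, inv_mul_cancel₀ hn.ne'])
  have h2 := h1.trans (h ‖ξ‖⁻¹ ξ ((one_le_inv₀ hn).2 hξ))
  rw [inv_pow] at h2
  have h3 : c * ‖ξ‖ ^ P.totalDegree ≤ A * rePoly P ξ := by
    calc c * ‖ξ‖ ^ P.totalDegree ≤ (A * (‖ξ‖ ^ P.totalDegree)⁻¹ * rePoly P ξ) *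
        ‖ξ‖ ^ P.totalDegree := by gcongr
      _ = A * rePoly P ξ := by field_simp
  rw [pow_succ, div_mul_eq_mul_div, div_mul_eq_mul_div, le_div_iff₀ hc]
  nlinarith

/-- Contracting `ξ` to the unit sphere loses at least a square, so `R` grows at least quadratically
at infinity. Finiteness of `R^#` and integrability of `exp (-cR)` rest on this. -/
theorem sq_norm_le (hP : IsPositiveHomogeneous P) :
    ∃ C : ℝ, 0 < C ∧ ∀ ξ : Fin d → ℝ, ‖ξ‖ ^ 2 ≤ C * rePoly P ξ + 1 := by
  obtain ⟨c, hc, hsph⟩ := exists_pos_le_on_sphere (continuous_rePoly P) hP.2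
  obtain ⟨A, hA, h⟩ := hP.rePoly_smul_le_sq
  refine ⟨A / c, by positivity, fun ξ => ?_⟩
  have hR := hP.nonneg ξ
  rcases le_total ‖ξ‖ 1 with h0 | h0
  · have : 0 ≤ A / c * rePoly P ξ := by positivity
    nlinarith [norm_nonneg ξ]
  have hn : 0 < ‖ξ‖ := by linarith
  have h1 := hsph (‖ξ‖⁻¹ • ξ) (by rw [norm_smul, norm_inv, norm_norm, inv_mul_cancel₀ hn.ne'])
  have h2 := h1.trans (h ‖ξ‖⁻¹ ξ (by positivity) (inv_le_one_of_one_le₀ h0))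
  rw [inv_pow] at h2
  have h3 : c * ‖ξ‖ ^ 2 ≤ A * rePoly P ξ := by
    calc c * ‖ξ‖ ^ 2 ≤ (A * (‖ξ‖ ^ 2)⁻¹ * rePoly P ξ) * ‖ξ‖ ^ 2 := by gcongr
      _ = A * rePoly P ξ := by field_simp
  have h4 : ‖ξ‖ ^ 2 ≤ A / c * rePoly P ξ := by
    rw [div_mul_eq_mul_div, le_div_iff₀ hc]; linarith
  linarith

end IsPositiveHomogeneous

/-! ### Complex shifts, the Legendre-Fenchel transform and integrals of `exp (-cR)`. -/

/-- The complex point `ξ - i ν`. -/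
def cshift {d : ℕ} (ξ ν : Fin d → ℝ) : Fin d → ℂ :=
  fun j => (ξ j : ℂ) - Complex.I * (ν j : ℂ)

namespace IsPositiveHomogeneous

variable {d : ℕ} {P : MvPolynomial (Fin d) ℂ}

/-- Writing `ξ - iν` as the point `s = -i/λ` on the line `ξ + s(λν)`, every nonconstant coefficient
gains a factor `1/λ`. A large `λ` makes the multiple of `R(ξ)` small, at the price of `R(λν) ≤ A λ^D
R(ν)`. -/
theorem norm_eval_cshift_sub_le (hP : IsPositiveHomogeneous P) {ε : ℝ} (hε : 0 < ε) :
    ∃ M : ℝ, 0 < M ∧ ∀ ξ ν : Fin d → ℝ,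
      ‖MvPolynomial.eval (cshift ξ ν) P - polyFun P ξ‖ ≤ ε * rePoly P ξ + M * rePoly P ν := by
  obtain ⟨C, hC, h⟩ := hP.norm_coeff_linePoly_le
  obtain ⟨A, hA, hpow⟩ := hP.rePoly_smul_le_pow
  set D := P.totalDegree
  set lam : ℝ := max 1 (D * C / ε) with hlam
  have hl1 : 1 ≤ lam := le_max_left _ _
  have hl0 : 0 < lam := by linarith
  refine ⟨ε * (A * lam ^ D), by positivity, fun ξ ν => ?_⟩
  set g := linePoly P (fun k => (ξ k : ℂ)) (fun k => ((lam • ν) k : ℂ)) with hg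
  have e1 : MvPolynomial.eval (cshift ξ ν) P = g.eval (-Complex.I / lam) := by
    rw [hg, eval_linePoly]
    congr 2
    ext k
    have : (lam : ℂ) ≠ 0 := by exact_mod_cast hl0.ne'
    simp only [cshift, Pi.smul_apply, smul_eq_mul, Complex.ofReal_mul]
    field_simp
    ring
  have e2 : polyFun P ξ = g.coeff 0 := by
    rw [Polynomial.coeff_zero_eq_eval_zero, hg, eval_linePoly]
    simp [polyFun]
  have e3 : MvPolynomial.eval (cshift ξ ν) P - polyFun P ξ =
      ∑ j ∈ Finset.range D, g.coeff (j + 1) * (-Complex.I / lam) ^ (j + 1) := by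
    rw [e1, e2, eval_linePoly_eq_sum, Finset.sum_range_succ']
    simp [hg, D]
  have hR1 := hP.nonneg ξ
  have hR2 := hP.nonneg ν
  have hR3 := hP.nonneg (lam • ν)
  have hz : ‖-Complex.I / (lam : ℂ)‖ = lam⁻¹ := by
    rw [norm_div, norm_neg, Complex.norm_I, Complex.norm_real, Real.norm_of_nonneg hl0.le, one_div]
  rw [e3]
  calc ‖∑ j ∈ Finset.range D, g.coeff (j + 1) * (-Complex.I / lam) ^ (j + 1)‖
      ≤ ∑ j ∈ Finset.range D, C * (rePoly P ξ + rePoly P (lam • ν)) * lam⁻¹ := by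
        refine (norm_sum_le _ _).trans (Finset.sum_le_sum fun j _ => ?_)
        rw [norm_mul, norm_pow, hz]
        have h1 : lam⁻¹ ^ (j + 1) ≤ lam⁻¹ :=
          pow_le_of_le_one (by positivity) (inv_le_one_of_one_le₀ hl1) (by omega)
        have h2 := h ξ (lam • ν) (j + 1)
        gcongr
    _ = (D * C / lam) * (rePoly P ξ + rePoly P (lam • ν)) := by
        simp; ring
    _ ≤ ε * (rePoly P ξ + A * lam ^ D * rePoly P ν) := by
        have h3 : D * C / lam ≤ ε := by
          rw [div_le_comm₀ hl0 hε]
          exact le_max_right _ _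
        have h4 := hpow lam ν hl1
        gcongr
    _ = _ := by ring

theorem bddAbove_legendre (hP : IsPositiveHomogeneous P) (x : Fin d → ℝ) :
    BddAbove (Set.range fun η : Fin d → ℝ => x ⬝ᵥ η - rePoly P η) := by
  obtain ⟨C, hC, h⟩ := hP.sq_norm_le
  set B : ℝ := d * ‖x‖
  refine ⟨C * B ^ 2 + 1 / C, ?_⟩
  rintro _ ⟨η, rfl⟩
  have h1 : x ⬝ᵥ η ≤ B * ‖η‖ := by
    calc x ⬝ᵥ η ≤ ∑ _j : Fin d, ‖x‖ * ‖η‖ := by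
          refine Finset.sum_le_sum fun j _ => ?_
          refine (le_abs_self _).trans ?_
          rw [abs_mul]
          exact mul_le_mul (norm_le_pi_norm x j) (norm_le_pi_norm η j) (abs_nonneg _) (norm_nonneg _)
      _ = B * ‖η‖ := by simp [B]; ring
  have h2 : (‖η‖ ^ 2 - 1) / C ≤ rePoly P η := by
    rw [div_le_iff₀ hC]; linarith [h η]
  have h3 : B * ‖η‖ ≤ C * B ^ 2 + ‖η‖ ^ 2 / C := by
    have h5 : C * B * ‖η‖ ≤ C * (C * B ^ 2) + ‖η‖ ^ 2 := by
      nlinarith [sq_nonneg (C * B - ‖η‖), sq_nonneg (C * B), sq_nonneg ‖η‖]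
    have h4 : C * (B * ‖η‖) ≤ C * (C * B ^ 2 + ‖η‖ ^ 2 / C) := by
      rw [mul_add, mul_div_cancel₀ _ hC.ne']; linarith
    exact le_of_mul_le_mul_left h4 hC
  have h6 : (‖η‖ ^ 2 - 1) / C = ‖η‖ ^ 2 / C - 1 / C := by ring
  change x ⬝ᵥ η - rePoly P η ≤ _
  linarith

/-- The Legendre-Fenchel transform over a small ball controls the full transform, uniformly for
arguments in a bounded set. -/
theorem exists_le_small_of_legendre (hP : IsPositiveHomogeneous P) {Y M ρ : ℝ}
    (hM : 0 < M) (hρ : 0 < ρ) :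
    ∃ lam : ℝ, 0 < lam ∧ ∀ y : Fin d → ℝ, ‖y‖ ≤ Y → ∀ ξ : Fin d → ℝ,
      ∃ ν : Fin d → ℝ, ‖ν‖ ≤ ρ ∧
        lam * (y ⬝ᵥ ξ - rePoly P ξ) ≤ y ⬝ᵥ ν - M * rePoly P ν := by
  obtain ⟨C, hC, h⟩ := hP.sq_norm_le
  obtain ⟨A, hA, hsq⟩ := hP.rePoly_smul_le_sq
  -- Any `ξ` with `R(ξ) ≤ y·ξ` satisfies `‖ξ‖² ≤ C d |Y| ‖ξ‖ + 1`, hence `‖ξ‖ ≤ X`. The other `ξ`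
  -- are served by `ν = 0`.
  set X : ℝ := C * (d * |Y|) + 1 with hX
  have hX1 : 1 ≤ X := by
    have : 0 ≤ C * (d * |Y|) := by positivity
    linarith
  have hX0 : 0 < X := by linarith
  -- With `ν = λξ`, the bound `λ ≤ ρ/X` keeps `ν` in the ball, and `λMA ≤ 1` turns `M R(λξ) ≤ M A λ²
  -- R(ξ)` into at most `λ R(ξ)`.
  set lam : ℝ := min 1 (min (ρ / X) (1 / (M * A))) with hlam
  have hl0 : 0 < lam := by positivity
  have hl1 : lam ≤ 1 := min_le_left _ _
  have hl2 : lam * X ≤ ρ := by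
    rw [← le_div_iff₀ hX0]
    exact (min_le_right _ _).trans (min_le_left _ _)
  have hl3 : lam * (M * A) ≤ 1 := by
    rw [← le_div_iff₀ (by positivity)]
    exact (min_le_right _ _).trans (min_le_right _ _)
  refine ⟨lam, hl0, fun y hy ξ => ?_⟩
  have hR := hP.nonneg ξ
  rcases lt_or_ge (y ⬝ᵥ ξ - rePoly P ξ) 0 with hneg | hnn
  · refine ⟨0, by simpa using hρ.le, ?_⟩
    rw [hP.rePoly_zero]
    simp only [dotProduct_zero, mul_zero, sub_zero]
    exact mul_nonpos_of_nonneg_of_nonpos hl0.le hneg.le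
  · refine ⟨lam • ξ, ?_, ?_⟩
    · have h1 : y ⬝ᵥ ξ ≤ d * |Y| * ‖ξ‖ := by
        calc y ⬝ᵥ ξ ≤ ∑ _j : Fin d, |Y| * ‖ξ‖ := by
              refine Finset.sum_le_sum fun j _ => ?_
              refine (le_abs_self _).trans ?_
              rw [abs_mul]
              exact mul_le_mul (((norm_le_pi_norm y j).trans hy).trans (le_abs_self Y))
                (norm_le_pi_norm ξ j) (abs_nonneg _) (abs_nonneg _)
          _ = d * |Y| * ‖ξ‖ := by simp; ring
      have h2 : ‖ξ‖ ≤ X := by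
        by_contra! hlt
        have h3 := h ξ
        have h4 : C * rePoly P ξ ≤ C * (d * |Y|) * ‖ξ‖ := by
          rw [mul_assoc]; gcongr; linarith
        nlinarith
      rw [norm_smul, Real.norm_of_nonneg hl0.le]
      exact (mul_le_mul_of_nonneg_left h2 hl0.le).trans hl2
    · have h1 := hsq lam ξ hl0.le hl1
      have h2 : M * rePoly P (lam • ξ) ≤ lam * rePoly P ξ := by
        calc M * rePoly P (lam • ξ) ≤ M * (A * lam ^ 2 * rePoly P ξ) := by gcongr
          _ = (lam * (M * A)) * (lam * rePoly P ξ) := by ring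
          _ ≤ 1 * (lam * rePoly P ξ) := by gcongr
          _ = _ := one_mul _
      rw [dotProduct_smul, smul_eq_mul]
      linarith

open MeasureTheory in
theorem lintegral_exp_neg_lt_top (hP : IsPositiveHomogeneous P) {c : ℝ} (hc : 0 < c) :
    ∫⁻ ξ : Fin d → ℝ, ENNReal.ofReal (Real.exp (-(c * rePoly P ξ))) < ⊤ := by
  obtain ⟨C, hC, h⟩ := hP.sq_norm_le
  -- The factor `d + 1` compares the Euclidean and sup norms; it is not `d` so that the denominator
  -- is positive also for `d = 0`.
  set b : ℝ := c / (C * (d + 1)) with hb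
  have hb0 : 0 < b := by positivity
  have hint : Integrable (fun ξ : Fin d → ℝ => ∏ j, Real.exp (-b * ξ j ^ 2)) :=
    Integrable.fintype_prod fun _ => integrable_exp_neg_mul_sq hb0
  have hle : ∀ ξ : Fin d → ℝ, Real.exp (-(c * rePoly P ξ)) ≤
      Real.exp (c / C) * ∏ j, Real.exp (-b * ξ j ^ 2) := by
    intro ξ
    rw [← Real.exp_sum, ← Real.exp_add, Real.exp_le_exp, ← Finset.mul_sum]
    have h1 : ∑ j, ξ j ^ 2 ≤ (d + 1) * ‖ξ‖ ^ 2 := by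
      calc ∑ j, ξ j ^ 2 ≤ ∑ _j : Fin d, ‖ξ‖ ^ 2 := by
            refine Finset.sum_le_sum fun j _ => ?_
            rw [← sq_abs]
            exact pow_le_pow_left₀ (abs_nonneg _) (norm_le_pi_norm ξ j) 2
        _ = d * ‖ξ‖ ^ 2 := by simp
        _ ≤ _ := by nlinarith [sq_nonneg ‖ξ‖]
    have h2 : b * ∑ j, ξ j ^ 2 ≤ c / C * ‖ξ‖ ^ 2 := by
      calc b * ∑ j, ξ j ^ 2 ≤ b * ((d + 1) * ‖ξ‖ ^ 2) := by gcongr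
        _ = c / C * ‖ξ‖ ^ 2 := by rw [hb]; field_simp
    have h3 : c / C * ‖ξ‖ ^ 2 ≤ c / C * (C * rePoly P ξ + 1) := by gcongr; exact h ξ
    have h4 : c / C * (C * rePoly P ξ + 1) = c * rePoly P ξ + c / C := by field_simp
    linarith
  have hint2 := hint.const_mul (Real.exp (c / C))
  calc ∫⁻ ξ : Fin d → ℝ, ENNReal.ofReal (Real.exp (-(c * rePoly P ξ)))
      ≤ ∫⁻ ξ : Fin d → ℝ, ‖Real.exp (c / C) * ∏ j, Real.exp (-b * ξ j ^ 2)‖ₑ := by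
        refine lintegral_mono fun ξ => ?_
        rw [Real.enorm_eq_ofReal (by positivity)]
        exact ENNReal.ofReal_le_ofReal (hle ξ)
    _ < ⊤ := hint2.2

open MeasureTheory in
-- Substituting `n^E ξ`, with Jacobian `n^(tr E)`, absorbs `n` into `R`. This is the source of the
-- decay `n^(-μ)`.
theorem lintegral_exp_neg_nsmul {E : Matrix (Fin d) (Fin d) ℝ}
    (hE : E ∈ exponentSet (rePoly P)) (c : ℝ) {n : ℝ} (hn : 0 < n) :
    ∫⁻ ξ : Fin d → ℝ, ENNReal.ofReal (Real.exp (-(n * (c * rePoly P ξ)))) =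
      ENNReal.ofReal ((n ^ E.trace)⁻¹) *
        ∫⁻ ξ : Fin d → ℝ, ENNReal.ofReal (Real.exp (-(c * rePoly P ξ))) := by
  have hdet := det_matPow hn E
  have hpos : 0 < n ^ E.trace := Real.rpow_pos_of_pos hn _
  have hmap := Real.map_matrix_volume_pi_eq_smul_volume_pi (M := matPow n E) (by
    rw [hdet]; exact hpos.ne')
  rw [hdet, abs_of_pos (inv_pos.2 hpos)] at hmap
  have hmeas : Measurable fun ξ : Fin d → ℝ => ENNReal.ofReal (Real.exp (-(c * rePoly P ξ))) := by
    have := (continuous_rePoly P)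
    exact (ENNReal.continuous_ofReal.comp (by fun_prop)).measurable
  have hlin : Measurable (Matrix.toLin' (matPow n E)) :=
    (LinearMap.continuous_of_finiteDimensional _).measurable
  rw [← smul_eq_mul, ← lintegral_smul_measure, ← hmap, lintegral_map hmeas hlin]
  refine lintegral_congr fun ξ => ?_
  rw [Matrix.toLin'_apply, ← hE n hn ξ, smul_eq_mul, mul_left_comm]

end IsPositiveHomogeneous

/-! ### Exponential sums on complex space -/

/-- The exponential sum `z ↦ ∑ i, c i * exp (I * (b i · z))` with real frequencies. -/
def expSum {d : ℕ} {ι : Type*} (s : Finset ι) (c : ι → ℂ) (b : ι → Fin d → ℝ) (z : Fin d → ℂ) : ℂ :=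
  ∑ i ∈ s, c i * Complex.exp (Complex.I * ∑ j, (b i j : ℂ) * z j)

@[simp] theorem cshift_zero {d : ℕ} (ξ : Fin d → ℝ) : cshift ξ 0 = fun j => (ξ j : ℂ) := by
  ext j; simp [cshift]

theorem norm_cshift_le {d : ℕ} (ξ ν : Fin d → ℝ) : ‖cshift ξ ν‖ ≤ ‖ξ‖ + ‖ν‖ := by
  refine (pi_norm_le_iff_of_nonneg (by positivity)).2 fun j => ?_
  refine (norm_sub_le _ _).trans ?_
  rw [norm_mul, Complex.norm_I, one_mul, Complex.norm_real, Complex.norm_real]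
  exact add_le_add (norm_le_pi_norm ξ j) (norm_le_pi_norm ν j)

theorem continuous_cshift {d : ℕ} :
    Continuous fun p : (Fin d → ℝ) × (Fin d → ℝ) => cshift p.1 p.2 := by
  unfold cshift; fun_prop

/-- Passing to a polynomial matters because `o(R)` on real space can be carried to complex space by
interpolation along lines. -/
theorem exists_taylor_expSum {d : ℕ} {ι : Type*} (s : Finset ι) (c : ι → ℂ)
    (b : ι → Fin d → ℝ) (N : ℕ) :
    ∃ Q : MvPolynomial (Fin d) ℂ, ∃ C : ℝ, 0 < C ∧ ∀ z : Fin d → ℂ, ‖z‖ ≤ 2 →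
      ‖expSum s c b z - MvPolynomial.eval z Q‖ ≤ C * ‖z‖ ^ N := by
  set B : ι → ℝ := fun i => ∑ j, |b i j| with hB
  have hB0 : ∀ i, 0 ≤ B i := fun i => Finset.sum_nonneg fun j _ => abs_nonneg _
  refine ⟨∑ i ∈ s, MvPolynomial.C (c i) * ∑ m ∈ Finset.range N, MvPolynomial.C ((m.factorial : ℂ)⁻¹) *
      (MvPolynomial.C Complex.I * ∑ j, MvPolynomial.C (b i j : ℂ) * MvPolynomial.X j) ^ m,
    ∑ i ∈ s, ‖c i‖ * (B i ^ N * Real.exp (2 * B i)) + 1, ?_, fun z hz => ?_⟩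
  · have : 0 ≤ ∑ i ∈ s, ‖c i‖ * (B i ^ N * Real.exp (2 * B i)) :=
      Finset.sum_nonneg fun i _ => mul_nonneg (norm_nonneg _)
        (mul_nonneg (pow_nonneg (hB0 i) _) (Real.exp_nonneg _))
    linarith
  · simp only [expSum, map_sum, map_mul, MvPolynomial.eval_C, map_pow, MvPolynomial.eval_X]
    rw [← Finset.sum_sub_distrib, add_mul, Finset.sum_mul]
    refine (norm_sum_le _ _).trans (le_add_of_le_of_nonneg (Finset.sum_le_sum fun i _ => ?_)
      (by positivity))
    rw [← mul_sub, norm_mul, mul_assoc]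
    refine mul_le_mul_of_nonneg_left ?_ (norm_nonneg _)
    set w : ℂ := Complex.I * ∑ j, (b i j : ℂ) * z j with hw
    have hwn : ‖w‖ ≤ B i * ‖z‖ := by
      rw [hw, norm_mul, Complex.norm_I, one_mul, hB, Finset.sum_mul]
      refine (norm_sum_le _ _).trans (Finset.sum_le_sum fun j _ => ?_)
      rw [norm_mul, Complex.norm_real, Real.norm_eq_abs]
      exact mul_le_mul_of_nonneg_left (norm_le_pi_norm z j) (abs_nonneg _)
    have h1 := Complex.norm_exp_sub_sum_le_norm_mul_exp w N
    have e : ∑ m ∈ Finset.range N, (m.factorial : ℂ)⁻¹ * w ^ m =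
        ∑ m ∈ Finset.range N, w ^ m / (m.factorial : ℂ) :=
      Finset.sum_congr rfl fun m _ => by rw [mul_comm, div_eq_mul_inv]
    rw [e]
    refine h1.trans ?_
    have hb := hB0 i
    calc ‖w‖ ^ N * Real.exp ‖w‖ ≤ (B i * ‖z‖) ^ N * Real.exp (2 * B i) := by
          gcongr
          nlinarith
      _ = B i ^ N * Real.exp (2 * B i) * ‖z‖ ^ N := by rw [mul_pow]; ring

/-- A polynomial that is negligible with respect to `Re P` on real space is negligible on complex
space. -/
theorem IsPositiveHomogeneous.eval_cshift_le {d : ℕ} {P : MvPolynomial (Fin d) ℂ}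
    (hP : IsPositiveHomogeneous P) {Q : MvPolynomial (Fin d) ℂ}
    (hQ : polyFun Q =o[𝓝 0] rePoly P) {ε : ℝ} (hε : 0 < ε) :
    ∃ δ : ℝ, 0 < δ ∧ ∀ ξ ν : Fin d → ℝ, ‖ξ‖ ≤ δ → ‖ν‖ ≤ δ →
      ‖MvPolynomial.eval (cshift ξ ν) Q‖ ≤ ε * (rePoly P ξ + rePoly P ν) := by
  set D := Q.totalDegree with hD
  obtain ⟨K, hK, hcoef⟩ := exists_coeff_bound D
  obtain ⟨C, hC, hadd⟩ := hP.add_nsmul_le D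
  set ε' : ℝ := ε / ((D + 1) * ((K + 1) * ((D + 1) * C))) with hε'
  have hε0 : 0 < ε' := by positivity
  obtain ⟨δ, hδ, hball⟩ := Metric.eventually_nhds_iff.1 (hQ.def hε0)
  -- All nodes `ξ + iν` with `i ≤ D` then lie in the `δ`-ball, since `(D + 1)/(D + 2) < 1`.
  refine ⟨δ / (D + 2), by positivity, fun ξ ν hξ hν => ?_⟩
  have hRξ := hP.nonneg ξ
  have hRν := hP.nonneg ν
  set g := linePoly Q (fun k => (ξ k : ℂ)) (fun k => (ν k : ℂ)) with hg
  have e1 : MvPolynomial.eval (cshift ξ ν) Q = g.eval (-Complex.I) := by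
    rw [hg, eval_linePoly]
    congr 2
    ext k
    simp only [cshift]
    ring
  have hval : ∀ i ∈ Finset.range (D + 1),
      ‖g.eval (i : ℂ)‖ ≤ ε' * (C * (rePoly P ξ + rePoly P ν)) := by
    intro i hi
    have hiD : i ≤ D := by simpa [Nat.lt_succ_iff] using hi
    have e2 : g.eval (i : ℂ) = polyFun Q (ξ + (i : ℝ) • ν) := by
      rw [hg, eval_linePoly]
      unfold polyFun
      congr 2
      ext k
      simp [mul_comm]
    rw [e2]
    have hiD' : (i : ℝ) ≤ D := by exact_mod_cast hiD
    have hnorm : ‖ξ + (i : ℝ) • ν‖ < δ := by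
      calc ‖ξ + (i : ℝ) • ν‖ ≤ ‖ξ‖ + ‖(i : ℝ) • ν‖ := norm_add_le _ _
        _ ≤ δ / (D + 2) + D * (δ / (D + 2)) := by
          rw [norm_smul, Real.norm_of_nonneg (Nat.cast_nonneg i)]
          gcongr
        _ = δ * ((D + 1) / (D + 2)) := by field_simp; ring
        _ < δ * 1 := by
          gcongr
          rw [div_lt_one (by positivity)]; linarith
        _ = δ := mul_one _
    have h1 := hball (show dist (ξ + (i : ℝ) • ν) 0 < δ by simpa using hnorm)
    refine h1.trans ?_
    rw [Real.norm_of_nonneg (hP.nonneg _)]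
    exact mul_le_mul_of_nonneg_left (hadd i hiD ξ ν) hε0.le
  have hsum : ∑ i ∈ Finset.range (D + 1), ‖g.eval (i : ℂ)‖ ≤
      (D + 1) * (ε' * (C * (rePoly P ξ + rePoly P ν))) := by
    refine (Finset.sum_le_sum hval).trans ?_
    simp
  rw [e1, eval_linePoly_eq_sum]
  calc ‖∑ j ∈ Finset.range (D + 1), g.coeff j * (-Complex.I) ^ j‖
      ≤ ∑ _j ∈ Finset.range (D + 1), (K + 1) * ((D + 1) * (ε' * (C * (rePoly P ξ + rePoly P ν)))) := by
        refine (norm_sum_le _ _).trans (Finset.sum_le_sum fun j _ => ?_)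
        rw [norm_mul, norm_pow, norm_neg, Complex.norm_I, one_pow, mul_one]
        refine (hcoef g (natDegree_linePoly_le _ _ _) j).trans ?_
        gcongr
        linarith
    _ = ε * (rePoly P ξ + rePoly P ν) := by
        simp only [Finset.sum_const, Finset.card_range, nsmul_eq_mul, Nat.cast_add, Nat.cast_one]
        rw [hε']
        field_simp

/-- With `a = ‖w‖²/2 - Re w` the square of the left side is `1 + 2a ≤ (1 + a)²`. -/
theorem norm_one_sub_le (w : ℂ) : ‖1 - w‖ ≤ 1 - w.re + ‖w‖ ^ 2 / 2 := by
  have h1 : |w.re| ≤ ‖w‖ := Complex.abs_re_le_norm w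
  have h2 : w.re ≤ ‖w‖ := (le_abs_self _).trans h1
  have h3 : ‖1 - w‖ ^ 2 = 1 - 2 * w.re + ‖w‖ ^ 2 := by
    rw [Complex.sq_norm, Complex.sq_norm, Complex.normSq_apply, Complex.normSq_apply]
    simp; ring
  have h5 : (1 - w.re + ‖w‖ ^ 2 / 2) ≥ 0 := by nlinarith [sq_nonneg (‖w‖ - 1)]
  refine abs_le_of_sq_le_sq' ?_ h5 |>.2
  rw [h3]
  nlinarith [sq_nonneg (w.re - ‖w‖ ^ 2 / 2)]

/-- If an exponential sum is `1 - P + o(Re P)` near `0` in real space, then its modulus has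
Gaussian-type bounds near `0` in complex space. -/
theorem IsPositiveHomogeneous.norm_expSum_cshift_le {d : ℕ} {P : MvPolynomial (Fin d) ℂ}
    (hP : IsPositiveHomogeneous P) {ι : Type*} {s : Finset ι} {c : ι → ℂ} {b : ι → Fin d → ℝ}
    (hf : (fun ξ : Fin d → ℝ => expSum s c b (cshift ξ 0) - 1 + polyFun P ξ) =o[𝓝 0] rePoly P) :
    ∃ M ρ : ℝ, 0 < M ∧ 0 < ρ ∧ ∀ ξ ν : Fin d → ℝ, ‖ξ‖ ≤ ρ → ‖ν‖ ≤ ρ →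
      ‖expSum s c b (cshift ξ ν)‖ ≤ Real.exp (-(rePoly P ξ / 2) + M * rePoly P ν) := by
  obtain ⟨Q, C₀, hC₀, hQ⟩ := exists_taylor_expSum s c b (P.totalDegree + 1)
  obtain ⟨C₁, hC₁, hlow⟩ := hP.pow_norm_le
  obtain ⟨A, hA, hPA⟩ := hP.norm_polyFun_le
  obtain ⟨M₁, hM₁, hsh⟩ := hP.norm_eval_cshift_sub_le (ε := 1 / 8) (by norm_num)
  have hlowo : (fun ξ : Fin d → ℝ => expSum s c b (cshift ξ 0) - polyFun Q ξ) =o[𝓝 0] rePoly P := by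
    refine Asymptotics.isLittleO_iff.2 fun ε hε => ?_
    have hb : Metric.ball (0 : Fin d → ℝ) (min 1 (ε / (C₀ * C₁))) ∈ 𝓝 (0 : Fin d → ℝ) :=
      Metric.ball_mem_nhds _ (by positivity)
    filter_upwards [hb] with ξ hξ
    rw [mem_ball_zero_iff, lt_min_iff, lt_div_iff₀ (by positivity)] at hξ
    have hn : ‖cshift ξ 0‖ ≤ ‖ξ‖ := by simpa using norm_cshift_le ξ 0
    have h1 := hQ (cshift ξ 0) (by linarith)
    have h2 := hlow ξ hξ.1.le
    have hR := hP.nonneg ξ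
    rw [Real.norm_of_nonneg hR]
    have e : polyFun Q ξ = MvPolynomial.eval (cshift ξ 0) Q := by rw [cshift_zero]; rfl
    rw [e]
    calc _ ≤ C₀ * ‖cshift ξ 0‖ ^ (P.totalDegree + 1) := h1
      _ ≤ C₀ * ‖ξ‖ ^ (P.totalDegree + 1) := by gcongr
      _ ≤ C₀ * (C₁ * ‖ξ‖ * rePoly P ξ) := by gcongr
      _ = ‖ξ‖ * (C₀ * C₁) * rePoly P ξ := by ring
      _ ≤ ε * rePoly P ξ := by gcongr; exact hξ.2.le
  -- On real space the Taylor polynomial `Q` is `1 - P + o(R)`, as the exponential sum is; being a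
  -- polynomial, the error extends to complex space.
  have hQ' : polyFun (Q - 1 + P) =o[𝓝 0] rePoly P := by
    refine (hf.sub hlowo).congr_left fun ξ => ?_
    simp only [polyFun, map_add, map_sub, map_one]
    ring
  obtain ⟨δ₁, hδ₁, hQδ⟩ := hP.eval_cshift_le hQ' (ε := 1 / 8) (by norm_num)
  set M₂ : ℝ := A + 1 + M₁ with hM₂
  have hcont : Continuous fun p : (Fin d → ℝ) × (Fin d → ℝ) =>
      ‖MvPolynomial.eval (cshift p.1 p.2) P‖ :=
    ((MvPolynomial.continuous_eval P).comp continuous_cshift).norm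
  have h0 : ‖MvPolynomial.eval (cshift (0 : Fin d → ℝ) 0) P‖ = 0 := by
    have := hP.polyFun_zero
    rw [cshift_zero]
    simpa [polyFun] using this
  have hsmall : ∀ᶠ p : (Fin d → ℝ) × (Fin d → ℝ) in 𝓝 0,
      ‖MvPolynomial.eval (cshift p.1 p.2) P‖ < 1 / (8 * M₂) := by
    refine hcont.continuousAt.eventually_lt continuousAt_const ?_
    change ‖MvPolynomial.eval (cshift (0 : Fin d → ℝ) 0) P‖ < _
    rw [h0]; positivity
  obtain ⟨δ₂, hδ₂, hPδ⟩ := Metric.eventually_nhds_iff.1 hsmall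
  set δ₃ : ℝ := 1 / (8 * (C₀ * (2 ^ P.totalDegree * C₁))) with hδ₃
  refine ⟨M₁ + 1, min (min δ₁ (δ₂ / 2)) (min δ₃ 1), by positivity, by positivity,
    fun ξ ν hξ hν => ?_⟩
  simp only [le_min_iff] at hξ hν
  obtain ⟨⟨hξ1, hξ2⟩, hξ3, hξ4⟩ := hξ
  obtain ⟨⟨hν1, hν2⟩, hν3, hν4⟩ := hν
  have hRξ := hP.nonneg ξ
  have hRν := hP.nonneg ν
  set z := cshift ξ ν with hz
  set p := MvPolynomial.eval z P with hp
  have hdecomp : expSum s c b z = (1 - p) + MvPolynomial.eval z (Q - 1 + P) +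
      (expSum s c b z - MvPolynomial.eval z Q) := by
    simp only [map_add, map_sub, map_one]
    ring
  have t1 : ‖p - polyFun P ξ‖ ≤ 1 / 8 * rePoly P ξ + M₁ * rePoly P ν := hsh ξ ν
  have t2 : rePoly P ξ - (1 / 8 * rePoly P ξ + M₁ * rePoly P ν) ≤ p.re := by
    have := (Complex.abs_re_le_norm (p - polyFun P ξ)).trans t1
    rw [Complex.sub_re] at this
    have := (abs_le.1 this).1
    change _ ≤ p.re - rePoly P ξ at this
    linarith
  have t3 : ‖p‖ ≤ M₂ * (rePoly P ξ + rePoly P ν) := by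
    have h1 : ‖p‖ ≤ ‖polyFun P ξ‖ + ‖p - polyFun P ξ‖ := by
      have := norm_add_le (polyFun P ξ) (p - polyFun P ξ)
      simpa using this
    have := hPA ξ
    rw [hM₂]
    nlinarith [mul_nonneg hA.le hRν, mul_nonneg hM₁.le hRξ]
  have t4 : ‖p‖ < 1 / (8 * M₂) := by
    refine hPδ (y := (ξ, ν)) ?_
    rw [dist_zero_right, Prod.norm_def]
    exact max_lt (by simp only; linarith) (by simp only; linarith)
  have t5 : ‖p‖ ^ 2 ≤ 1 / 8 * (rePoly P ξ + rePoly P ν) := by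
    have hM2 : 0 < M₂ := by positivity
    calc ‖p‖ ^ 2 = ‖p‖ * ‖p‖ := sq _
      _ ≤ 1 / (8 * M₂) * (M₂ * (rePoly P ξ + rePoly P ν)) := by gcongr
      _ = _ := by field_simp
  have t6 := hQδ ξ ν hξ1 hν1
  have t7 : ‖expSum s c b z - MvPolynomial.eval z Q‖ ≤ 1 / 8 * (rePoly P ξ + rePoly P ν) := by
    have hzn := norm_cshift_le ξ ν
    have h1 := hlow ξ hξ4
    have h2 := hlow ν hν4
    calc _ ≤ C₀ * ‖z‖ ^ (P.totalDegree + 1) := hQ z (by linarith)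
      _ ≤ C₀ * (‖ξ‖ + ‖ν‖) ^ (P.totalDegree + 1) := by gcongr
      _ ≤ C₀ * (2 ^ P.totalDegree * (‖ξ‖ ^ (P.totalDegree + 1) + ‖ν‖ ^ (P.totalDegree + 1))) := by
        gcongr
        simpa using add_pow_le (norm_nonneg ξ) (norm_nonneg ν) (P.totalDegree + 1)
      _ ≤ C₀ * (2 ^ P.totalDegree * (C₁ * δ₃ * rePoly P ξ + C₁ * δ₃ * rePoly P ν)) := by
        have h3 : C₁ * ‖ξ‖ * rePoly P ξ ≤ C₁ * δ₃ * rePoly P ξ := by gcongr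
        have h4 : C₁ * ‖ν‖ * rePoly P ν ≤ C₁ * δ₃ * rePoly P ν := by gcongr
        gcongr <;> linarith
      _ = 1 / 8 * (rePoly P ξ + rePoly P ν) := by rw [hδ₃]; field_simp
  have t8 := norm_one_sub_le p
  have t9 : ‖expSum s c b z‖ ≤ ‖1 - p‖ + ‖MvPolynomial.eval z (Q - 1 + P)‖ +
      ‖expSum s c b z - MvPolynomial.eval z Q‖ := by
    conv_lhs => rw [hdecomp]
    exact norm_add₃_le
  -- The errors in `t1`, `t5` (halved by `t8`), `t6` and `t7` cost `1/8 + 1/16 + 1/8 + 1/8 = 7/16 <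
  -- 1/2` of `R(ξ)`, and `M₁ + 5/16 < M₁ + 1` times `R(ν)`.
  have t10 := Real.add_one_le_exp (-(rePoly P ξ / 2) + (M₁ + 1) * rePoly P ν)
  nlinarith

/-! ### The Fourier transform on complex space -/

/-- The character `z ↦ exp (I * (x · z))` of `ℤ^d`, on complex space. -/
def char {d : ℕ} (x : Fin d → ℤ) (z : Fin d → ℂ) : ℂ :=
  Complex.exp (Complex.I * ∑ j, (((x j : ℤ) : ℝ) : ℂ) * z j)

/-- The trigonometric sum with coefficients `φ` over a finite set of lattice points. -/
def trigSum {d : ℕ} (s : Finset (Fin d → ℤ)) (φ : (Fin d → ℤ) → ℂ) (z : Fin d → ℂ) : ℂ :=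
  ∑ x ∈ s, φ x * char x z

theorem char_add {d : ℕ} (x y : Fin d → ℤ) (z : Fin d → ℂ) :
    char (x + y) z = char x z * char y z := by
  rw [char, char, char, ← Complex.exp_add, ← mul_add, ← Finset.sum_add_distrib]
  congr 3
  ext j
  simp; ring

@[simp] theorem char_zero {d : ℕ} (z : Fin d → ℂ) : char 0 z = 1 := by
  simp [char]

theorem continuous_char {d : ℕ} (x : Fin d → ℤ) : Continuous (char x) := by
  unfold char; fun_prop

theorem continuous_trigSum {d : ℕ} (s : Finset (Fin d → ℤ)) (φ : (Fin d → ℤ) → ℂ) :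
    Continuous (trigSum s φ) := by
  unfold trigSum
  exact continuous_finsetSum _ fun x _ => continuous_const.mul (continuous_char x)

theorem char_cshift {d : ℕ} (x : Fin d → ℤ) (ξ ν : Fin d → ℝ) :
    char x (cshift ξ ν) =
      char x (cshift ξ 0) * (Real.exp ((fun j => (x j : ℝ)) ⬝ᵥ ν) : ℂ) := by
  rw [char, char, Complex.ofReal_exp, ← Complex.exp_add]
  congr 1
  simp only [cshift, dotProduct, Complex.ofReal_sum, Finset.mul_sum, ← Finset.sum_add_distrib]
  refine Finset.sum_congr rfl fun j _ => ?_
  have := Complex.I_mul_I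
  simp only [Pi.zero_apply, Complex.ofReal_zero, mul_zero, sub_zero, Complex.ofReal_mul]
  linear_combination (-((x j : ℝ) : ℂ) * (ν j : ℂ)) * this

theorem norm_char_real {d : ℕ} (x : Fin d → ℤ) (ξ : Fin d → ℝ) : ‖char x (cshift ξ 0)‖ = 1 := by
  have : Complex.I * ∑ j, (((x j : ℤ) : ℝ) : ℂ) * (cshift ξ 0) j =
      ((∑ j, (x j : ℝ) * ξ j : ℝ) : ℂ) * Complex.I := by
    simp [mul_comm]
  rw [char, this, Complex.norm_exp_ofReal_mul_I]

theorem norm_char_cshift {d : ℕ} (x : Fin d → ℤ) (ξ ν : Fin d → ℝ) :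
    ‖char x (cshift ξ ν)‖ = Real.exp ((fun j => (x j : ℝ)) ⬝ᵥ ν) := by
  rw [char_cshift, norm_mul, norm_char_real, one_mul, Complex.norm_real,
    Real.norm_of_nonneg (Real.exp_nonneg _)]

theorem char_add_period {d : ℕ} (x k : Fin d → ℤ) (ξ ν : Fin d → ℝ) :
    char x (cshift (fun j => ξ j + k j * (2 * Real.pi)) ν) = char x (cshift ξ ν) := by
  rw [char, char, Complex.exp_eq_exp_iff_exists_int]
  refine ⟨∑ j, x j * k j, ?_⟩
  simp only [cshift, Finset.mul_sum, Int.cast_sum, Finset.sum_mul, ← Finset.sum_add_distrib]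
  refine Finset.sum_congr rfl fun j _ => ?_
  push_cast
  ring

theorem trigSum_add_period {d : ℕ} (s : Finset (Fin d → ℤ)) (φ : (Fin d → ℤ) → ℂ)
    (k : Fin d → ℤ) (ξ ν : Fin d → ℝ) :
    trigSum s φ (cshift (fun j => ξ j + k j * (2 * Real.pi)) ν) = trigSum s φ (cshift ξ ν) := by
  simp only [trigSum, char_add_period]

theorem fourier_eq_trigSum {d : ℕ} {s : Finset (Fin d → ℤ)} {φ : (Fin d → ℤ) → ℂ}
    (hs : Function.support φ ⊆ s) (ξ : Fin d → ℝ) :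
    fourier φ ξ = trigSum s φ (cshift ξ 0) := by
  unfold fourier trigSum
  rw [tsum_eq_sum (s := s)]
  · refine Finset.sum_congr rfl fun x _ => ?_
    simp [char, dotProduct]
  · intro x hx
    have : φ x = 0 := by
      by_contra h
      exact hx (hs h)
    rw [this, zero_mul]

/-- The trigonometric sum is uniformly continuous in imaginary directions. -/
theorem exists_trigSum_cshift_sub_le {d : ℕ} (s : Finset (Fin d → ℤ)) (φ : (Fin d → ℤ) → ℂ)
    {ε : ℝ} (hε : 0 < ε) :
    ∃ ρ : ℝ, 0 < ρ ∧ ∀ ξ ν : Fin d → ℝ, ‖ν‖ ≤ ρ →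
      ‖trigSum s φ (cshift ξ ν) - trigSum s φ (cshift ξ 0)‖ ≤ ε := by
  set a : (Fin d → ℝ) → ℝ := fun ν =>
    ∑ x ∈ s, ‖φ x‖ * |Real.exp ((fun j => (x j : ℝ)) ⬝ᵥ ν) - 1| with ha
  have hac : Continuous a := by
    simp only [ha, dotProduct]
    fun_prop
  have ha0 : a 0 = 0 := by simp [ha]
  have : ∀ᶠ ν in 𝓝 (0 : Fin d → ℝ), a ν < ε :=
    hac.continuousAt.eventually_lt continuousAt_const (by rw [ha0]; exact hε)
  obtain ⟨δ, hδ, h⟩ := Metric.eventually_nhds_iff.1 this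
  refine ⟨δ / 2, by positivity, fun ξ ν hν => ?_⟩
  refine le_trans ?_ (h (y := ν) (by rw [dist_zero_right]; linarith)).le
  rw [trigSum, trigSum, ← Finset.sum_sub_distrib]
  refine (norm_sum_le _ _).trans (Finset.sum_le_sum fun x _ => ?_)
  rw [← mul_sub, norm_mul, char_cshift]
  refine mul_le_mul_of_nonneg_left (le_of_eq ?_) (norm_nonneg _)
  rw [show char x (cshift ξ 0) * (Real.exp ((fun j => (x j : ℝ)) ⬝ᵥ ν) : ℂ) - char x (cshift ξ 0) =
    char x (cshift ξ 0) * ((Real.exp ((fun j => (x j : ℝ)) ⬝ᵥ ν) - 1 : ℝ) : ℂ) by push_cast; ring,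
    norm_mul, norm_char_real, one_mul, Complex.norm_real, Real.norm_eq_abs]

/-! ### The local estimate -/

/-- With `g = -P + Υ`, which is `O(R)` and tends to `0`, the error `exp g - 1 - g = O(g²)` is
`o(R)`. -/
theorem isLittleO_exp_sub {d : ℕ} {P : MvPolynomial (Fin d) ℂ} (hP : IsPositiveHomogeneous P)
    {Υ : (Fin d → ℝ) → ℂ} (hΥ : Υ =o[𝓝 0] rePoly P) :
    (fun ξ => Complex.exp (-polyFun P ξ + Υ ξ) - 1 + polyFun P ξ) =o[𝓝 0] rePoly P := by
  obtain ⟨A, hA, hPA⟩ := hP.norm_polyFun_le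
  set g : (Fin d → ℝ) → ℂ := fun ξ => -polyFun P ξ + Υ ξ with hg
  have hPO : (fun ξ => -polyFun P ξ) =O[𝓝 0] rePoly P :=
    Asymptotics.isBigO_iff.2 ⟨A, Filter.Eventually.of_forall fun ξ => by
      rw [norm_neg, Real.norm_of_nonneg (hP.nonneg ξ)]
      exact hPA ξ⟩
  have hgO : g =O[𝓝 0] rePoly P := hPO.add hΥ.isBigO
  have hR0 : Filter.Tendsto (rePoly P) (𝓝 0) (𝓝 0) := by
    have := (continuous_rePoly P).tendsto 0
    rwa [hP.rePoly_zero] at this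
  have hg0 : Filter.Tendsto g (𝓝 0) (𝓝 0) := hgO.trans_tendsto hR0
  have hquad : (fun ξ => Complex.exp (g ξ) - 1 - g ξ) =O[𝓝 0] fun ξ => g ξ * g ξ := by
    refine Asymptotics.isBigO_iff.2 ⟨1, ?_⟩
    have : ∀ᶠ ξ in 𝓝 (0 : Fin d → ℝ), ‖g ξ‖ < 1 :=
      hg0.norm.eventually_lt_const (by simp)
    filter_upwards [this] with ξ hξ
    rw [one_mul, norm_mul, ← sq]
    exact Complex.norm_exp_sub_one_sub_id_le hξ.le
  have hsq : (fun ξ => g ξ * g ξ) =o[𝓝 0] rePoly P := by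
    have h1 : g =o[𝓝 0] fun _ => (1 : ℝ) := (Asymptotics.isLittleO_one_iff ℝ).2 hg0
    simpa using h1.mul_isBigO hgO
  refine ((hquad.trans_isLittleO hsq).add hΥ).congr_left fun ξ => ?_
  simp only [hg]
  ring

/-- Dividing by `φ̂(ξ₀) exp (i α·z)` removes the phase and the drift. What remains is an exponential
sum with real, generally nonintegral frequencies `x - α`, equal to `1 - P + o(R)` on real space. -/
theorem IsPosHomType.norm_trigSum_le {d : ℕ} {s : Finset (Fin d → ℤ)} {φ : (Fin d → ℤ) → ℂ}
    (hs : Function.support φ ⊆ s) {ξ₀ α : Fin d → ℝ} {P : MvPolynomial (Fin d) ℂ}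
    (h : IsPosHomType φ ξ₀ α P) (h1 : ‖fourier φ ξ₀‖ = 1) :
    ∃ M ρ : ℝ, 0 < M ∧ 0 < ρ ∧ ∀ ξ ν : Fin d → ℝ, ‖ξ‖ ≤ ρ → ‖ν‖ ≤ ρ →
      ‖trigSum s φ (cshift (ξ₀ + ξ) ν)‖ ≤
        Real.exp (α ⬝ᵥ ν - rePoly P ξ / 2 + M * rePoly P ν) := by
  obtain ⟨hP, Υ, hlog, hΥ⟩ := h
  set w := fourier φ ξ₀ with hw
  have hw0 : w ≠ 0 := by
    intro h0; rw [h0, norm_zero] at h1; exact zero_ne_one h1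
  set c : (Fin d → ℤ) → ℂ := fun x => φ x * char x (cshift ξ₀ 0) / w with hc
  set b : (Fin d → ℤ) → Fin d → ℝ := fun x j => x j - α j with hb
  have hfac : ∀ ξ ν : Fin d → ℝ, trigSum s φ (cshift (ξ₀ + ξ) ν) =
      w * Complex.exp (Complex.I * ∑ j, (α j : ℂ) * cshift ξ ν j) * expSum s c b (cshift ξ ν) := by
    intro ξ ν
    rw [trigSum, expSum, Finset.mul_sum]
    refine Finset.sum_congr rfl fun x _ => ?_
    have e : char x (cshift (ξ₀ + ξ) ν) = char x (cshift ξ₀ 0) *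
        (Complex.exp (Complex.I * ∑ j, (α j : ℂ) * cshift ξ ν j) *
          Complex.exp (Complex.I * ∑ j, (b x j : ℂ) * cshift ξ ν j)) := by
      rw [char, char, ← Complex.exp_add, ← Complex.exp_add]
      congr 1
      rw [← mul_add, ← mul_add, ← Finset.sum_add_distrib, ← Finset.sum_add_distrib]
      congr 1
      refine Finset.sum_congr rfl fun j _ => ?_
      simp only [hb, cshift, Pi.add_apply, Pi.zero_apply]
      push_cast
      ring
    rw [e, hc]
    field_simp
  have hnear : ∀ᶠ ξ in 𝓝 (0 : Fin d → ℝ), fourier φ (ξ + ξ₀) ≠ 0 := by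
    have hcont : Continuous fun ξ : Fin d → ℝ => fourier φ (ξ + ξ₀) := by
      simp only [fourier_eq_trigSum hs]
      refine (continuous_trigSum s φ).comp ?_
      unfold cshift; fun_prop
    refine hcont.continuousAt.eventually_ne ?_
    rw [zero_add]; exact hw0
  have hf : (fun ξ : Fin d → ℝ => expSum s c b (cshift ξ 0) - 1 + polyFun P ξ) =o[𝓝 0] rePoly P := by
    refine (isLittleO_exp_sub hP hΥ).congr' ?_ Filter.EventuallyEq.rfl
    filter_upwards [hlog, hnear] with ξ hξ hne
    congr 2
    have h2 := hfac ξ 0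
    rw [← fourier_eq_trigSum hs, add_comm ξ₀ ξ] at h2
    have h3 : fourier φ (ξ + ξ₀) / w = Complex.exp (Gam φ ξ₀ ξ) := by
      rw [Gam, Complex.exp_log (div_ne_zero hne hw0)]
    have e4 : ∑ j, (α j : ℂ) * cshift ξ 0 j = ((α ⬝ᵥ ξ : ℝ) : ℂ) := by
      simp [cshift, dotProduct]
    rw [e4] at h2
    have h5 : Complex.exp (Complex.I * ((α ⬝ᵥ ξ : ℝ) : ℂ)) * expSum s c b (cshift ξ 0) =
        Complex.exp (Complex.I * ((α ⬝ᵥ ξ : ℝ) : ℂ)) * Complex.exp (-polyFun P ξ + Υ ξ) := by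
      rw [← Complex.exp_add, ← add_assoc, ← sub_eq_add_neg, ← hξ, ← h3, h2]
      field_simp
    exact (mul_left_cancel₀ (Complex.exp_ne_zero _) h5).symm
  obtain ⟨M, ρ, hM, hρ, hbound⟩ := hP.norm_expSum_cshift_le hf
  refine ⟨M, ρ, hM, hρ, fun ξ ν hξ hν => ?_⟩
  have hb2 := hbound ξ ν hξ hν
  rw [hfac, norm_mul, norm_mul, h1, one_mul, Complex.norm_exp]
  have e : (Complex.I * ∑ j, (α j : ℂ) * cshift ξ ν j).re = α ⬝ᵥ ν := by
    simp [cshift, dotProduct, Finset.mul_sum]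
  rw [e, show α ⬝ᵥ ν - rePoly P ξ / 2 + M * rePoly P ν =
    α ⬝ᵥ ν + (-(rePoly P ξ / 2) + M * rePoly P ν) by ring, Real.exp_add]
  gcongr

/-! ### Trigonometric polynomials and their coefficients -/

/-- The characters as a monoid homomorphism. -/
def charHom (d : ℕ) : Multiplicative (Fin d → ℤ) →* ((Fin d → ℂ) → ℂ) where
  toFun x := char x.toAdd
  map_one' := by ext z; simp
  map_mul' x y := by ext z; simp [char_add]

/-- The algebra of trigonometric polynomials, as functions on `ℂ^d`. -/
def trigPoly (d : ℕ) : Subalgebra ℂ ((Fin d → ℂ) → ℂ) :=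
  Algebra.adjoin ℂ (Set.range (charHom d))

theorem char_mem_trigPoly {d : ℕ} (x : Fin d → ℤ) : char x ∈ trigPoly d :=
  Algebra.subset_adjoin ⟨Multiplicative.ofAdd x, rfl⟩

theorem trigSum_mem_trigPoly {d : ℕ} (s : Finset (Fin d → ℤ)) (φ : (Fin d → ℤ) → ℂ) :
    trigSum s φ ∈ trigPoly d := by
  have : trigSum s φ = ∑ x ∈ s, φ x • char x := by
    ext z; simp [trigSum]
  rw [this]
  exact Subalgebra.sum_mem _ fun x _ => Subalgebra.smul_mem _ (char_mem_trigPoly x) _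

/-- Products of characters are characters, so the algebra they generate is their linear span and no
multiplicative case arises. -/
theorem trigPoly_induction {d : ℕ} {p : ((Fin d → ℂ) → ℂ) → Prop}
    (hchar : ∀ x, p (char x)) (hzero : p 0) (hadd : ∀ F G, p F → p G → p (F + G))
    (hsmul : ∀ (c : ℂ) F, p F → p (c • F)) {F : (Fin d → ℂ) → ℂ} (hF : F ∈ trigPoly d) : p F := by
  have h : F ∈ Submodule.span ℂ (Set.range (charHom d)) := by
    rw [← MonoidHom.coe_mrange, ← Submonoid.closure_eq (MonoidHom.mrange (charHom d)),
      MonoidHom.coe_mrange, ← Algebra.adjoin_eq_span]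
    exact hF
  induction h using Submodule.span_induction with
  | mem x hx => obtain ⟨y, rfl⟩ := hx; exact hchar y.toAdd
  | zero => exact hzero
  | add x y hx hy ihx ihy =>
    have mem : ∀ z ∈ Submodule.span ℂ (Set.range (charHom d)), z ∈ trigPoly d := fun z hz =>
      Algebra.span_le_adjoin ℂ _ hz
    exact hadd _ _ (ihx (mem x hx)) (ihy (mem y hy))
  | smul a x hx ih => exact hsmul a x (ih (Algebra.span_le_adjoin ℂ _ hx))

theorem continuous_of_mem_trigPoly {d : ℕ} {F : (Fin d → ℂ) → ℂ} (hF : F ∈ trigPoly d) :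
    Continuous F := by
  refine trigPoly_induction continuous_char continuous_const (fun F G hF hG => hF.add hG)
    (fun c F hF => hF.const_smul c) hF

/-! ### Fourier coefficients and shifts of the contour. -/

/-- The closed cube `[-π, π]^d`. -/
def cube (d : ℕ) : Set (Fin d → ℝ) := Set.univ.pi fun _ => Set.Icc (-Real.pi) Real.pi

theorem isCompact_cube (d : ℕ) : IsCompact (cube d) := isCompact_univ_pi fun _ => isCompact_Icc

open MeasureTheory

theorem integral_char_real {d : ℕ} (x : Fin d → ℤ) :
    ∫ ξ in cube d, char x (cshift ξ 0) = if x = 0 then ((2 * Real.pi) ^ d : ℂ) else 0 := by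
  have hprod : ∀ ξ : Fin d → ℝ, char x (cshift ξ 0) =
      ∏ j, Complex.exp (Complex.I * x j * ξ j) := by
    intro ξ
    rw [← Complex.exp_sum, char, Finset.mul_sum]
    congr 1
    refine Finset.sum_congr rfl fun j _ => ?_
    simp [mul_assoc]
  simp only [hprod]
  rw [cube, volume_pi, Measure.restrict_pi_pi,
    integral_fintype_prod_eq_prod (fun j (t : ℝ) => Complex.exp (Complex.I * x j * t))]
  have hone : ∀ k : ℤ, ∫ t in Set.Icc (-Real.pi) Real.pi, Complex.exp (Complex.I * k * (t : ℝ)) =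
      if k = 0 then (2 * Real.pi : ℂ) else 0 := by
    intro k
    rw [integral_Icc_eq_integral_Ioc, ← intervalIntegral.integral_of_le (by linarith [Real.pi_pos])]
    split_ifs with hk
    · subst hk
      simp
      ring
    · have hne : Complex.I * (k : ℂ) ≠ 0 := mul_ne_zero Complex.I_ne_zero (by exact_mod_cast hk)
      rw [integral_exp_mul_complex hne, div_eq_zero_iff]
      left
      rw [sub_eq_zero, Complex.exp_eq_exp_iff_exists_int]
      exact ⟨k, by push_cast; ring⟩
  simp only [hone]
  split_ifs with hx
  · subst hx
    simp
  · obtain ⟨j, hj⟩ := Function.ne_iff.1 hx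
    exact Finset.prod_eq_zero (Finset.mem_univ j) (if_neg hj)

/-- The `x`-th Fourier coefficient of a function on `ℂ^d`, computed on real space. -/
def coef {d : ℕ} (F : (Fin d → ℂ) → ℂ) (x : Fin d → ℤ) : ℂ :=
  ((2 * Real.pi) ^ d : ℂ)⁻¹ * ∫ ξ in cube d, F (cshift ξ 0) * char (-x) (cshift ξ 0)

theorem continuous_mul_char_cshift {d : ℕ} {F : (Fin d → ℂ) → ℂ} (hF : F ∈ trigPoly d)
    (x : Fin d → ℤ) (ν : Fin d → ℝ) :
    Continuous fun ξ : Fin d → ℝ => F (cshift ξ ν) * char (-x) (cshift ξ ν) := by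
  have h : Continuous fun ξ : Fin d → ℝ => cshift ξ ν := by unfold cshift; fun_prop
  exact ((continuous_of_mem_trigPoly hF).comp h).mul ((continuous_char _).comp h)

theorem integrableOn_mul_char_cshift {d : ℕ} {F : (Fin d → ℂ) → ℂ} (hF : F ∈ trigPoly d)
    (x : Fin d → ℤ) (ν : Fin d → ℝ) :
    IntegrableOn (fun ξ : Fin d → ℝ => F (cshift ξ ν) * char (-x) (cshift ξ ν)) (cube d) :=
  (continuous_mul_char_cshift hF x ν).continuousOn.integrableOn_compact (isCompact_cube d)

theorem coef_sum {d : ℕ} {ι : Type*} (t : Finset ι) {F : ι → (Fin d → ℂ) → ℂ}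
    (hF : ∀ i ∈ t, F i ∈ trigPoly d) (x : Fin d → ℤ) :
    coef (∑ i ∈ t, F i) x = ∑ i ∈ t, coef (F i) x := by
  unfold coef
  rw [← Finset.mul_sum, ← integral_finsetSum _ fun i hi =>
    integrableOn_mul_char_cshift (hF i hi) x 0]
  simp only [Finset.sum_apply, Finset.sum_mul]

theorem coef_smul {d : ℕ} (c : ℂ) (F : (Fin d → ℂ) → ℂ) (x : Fin d → ℤ) :
    coef (c • F) x = c * coef F x := by
  unfold coef
  simp only [Pi.smul_apply, smul_eq_mul, mul_assoc]
  rw [integral_const_mul]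
  ring

theorem coef_char_mul {d : ℕ} (y : Fin d → ℤ) (F : (Fin d → ℂ) → ℂ) (x : Fin d → ℤ) :
    coef (char y * F) x = coef F (x - y) := by
  unfold coef
  congr 2
  ext ξ
  rw [show -(x - y) = y + -x by abel, char_add, Pi.mul_apply]
  ring

theorem coef_char {d : ℕ} (y x : Fin d → ℤ) : coef (char y) x = if x = y then 1 else 0 := by
  unfold coef
  have : ∀ ξ : Fin d → ℝ, char y (cshift ξ 0) * char (-x) (cshift ξ 0) =
      char (y - x) (cshift ξ 0) := fun ξ => by rw [sub_eq_add_neg, char_add]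
  simp only [this, integral_char_real, sub_eq_zero]
  have hpi : ((2 * Real.pi) ^ d : ℂ) ≠ 0 := by
    have : (Real.pi : ℂ) ≠ 0 := by exact_mod_cast Real.pi_ne_zero
    exact pow_ne_zero _ (mul_ne_zero two_ne_zero this)
  by_cases h : y = x
  · simp [h]
  · simp [h, Ne.symm h]

/-- The contour of integration defining a Fourier coefficient can be shifted. -/
theorem coef_eq_shift {d : ℕ} {F : (Fin d → ℂ) → ℂ} (hF : F ∈ trigPoly d) (x : Fin d → ℤ)
    (ν : Fin d → ℝ) :
    coef F x = ((2 * Real.pi) ^ d : ℂ)⁻¹ *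
      ∫ ξ in cube d, F (cshift ξ ν) * char (-x) (cshift ξ ν) := by
  unfold coef
  congr 1
  -- Membership is carried through the induction to supply the integrability needed for sums.
  suffices h : F ∈ trigPoly d ∧ ∫ ξ in cube d, F (cshift ξ 0) * char (-x) (cshift ξ 0) =
      ∫ ξ in cube d, F (cshift ξ ν) * char (-x) (cshift ξ ν) from h.2
  refine trigPoly_induction (p := fun F => F ∈ trigPoly d ∧
    ∫ ξ in cube d, F (cshift ξ 0) * char (-x) (cshift ξ 0) =
      ∫ ξ in cube d, F (cshift ξ ν) * char (-x) (cshift ξ ν)) ?_ ?_ ?_ ?_ hF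
  -- For a single character the shift multiplies the integral by a constant; the integral is zero
  -- unless the frequency is zero, and then the constant is one. No Cauchy theorem is needed.
  · refine fun y => ⟨char_mem_trigPoly y, ?_⟩
    simp only [← char_add]
    simp_rw [char_cshift _ _ ν]
    rw [integral_mul_const, integral_char_real]
    split_ifs with h
    · have : (fun j => (((y + -x) j : ℤ) : ℝ)) = (0 : Fin d → ℝ) := by rw [h]; ext; simp
      rw [this]
      simp
    · simp
  · exact ⟨Subalgebra.zero_mem _, by simp⟩
  · rintro F G ⟨hF, h1⟩ ⟨hG, h2⟩
    refine ⟨Subalgebra.add_mem _ hF hG, ?_⟩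
    simp only [Pi.add_apply, add_mul]
    rw [integral_add (integrableOn_mul_char_cshift hF x 0) (integrableOn_mul_char_cshift hG x 0),
      integral_add (integrableOn_mul_char_cshift hF x ν) (integrableOn_mul_char_cshift hG x ν),
      h1, h2]
  · rintro c F ⟨hF, h1⟩
    refine ⟨Subalgebra.smul_mem _ hF c, ?_⟩
    simp only [Pi.smul_apply, smul_eq_mul, mul_assoc, integral_const_mul, h1]

/-- On the shifted contour `char (-x)` has constant modulus `exp (-x·ν)`; the factor `(2π)^(-d) ≤ 1`
is dropped. -/
theorem enorm_coef_le {d : ℕ} {F : (Fin d → ℂ) → ℂ} (hF : F ∈ trigPoly d) (x : Fin d → ℤ)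
    (ν : Fin d → ℝ) :
    ‖coef F x‖ₑ ≤ ENNReal.ofReal (Real.exp (-((fun j => (x j : ℝ)) ⬝ᵥ ν))) *
      ∫⁻ ξ in cube d, ‖F (cshift ξ ν)‖ₑ := by
  rw [coef_eq_shift hF x ν, enorm_mul]
  have h1 : ‖((2 * Real.pi) ^ d : ℂ)⁻¹‖ₑ ≤ 1 := by
    rw [← enorm_norm, ← enorm_one (G := ℝ), enorm_le_iff_norm_le, norm_norm, norm_inv, norm_one]
    refine inv_le_one_of_one_le₀ ?_
    rw [norm_pow]
    refine one_le_pow₀ ?_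
    rw [norm_mul, Complex.norm_real, Real.norm_of_nonneg Real.pi_pos.le, Complex.norm_ofNat]
    linarith [Real.pi_gt_three]
  have h2 : ∀ ξ : Fin d → ℝ, ‖F (cshift ξ ν) * char (-x) (cshift ξ ν)‖ₑ =
      ENNReal.ofReal (Real.exp (-((fun j => (x j : ℝ)) ⬝ᵥ ν))) * ‖F (cshift ξ ν)‖ₑ := by
    intro ξ
    rw [enorm_mul, mul_comm, ← ofReal_norm, norm_char_cshift]
    congr 3
    rw [← neg_dotProduct]
    congr 1
    ext j; simp
  calc _ ≤ 1 * ‖∫ ξ in cube d, F (cshift ξ ν) * char (-x) (cshift ξ ν)‖ₑ := by gcongr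
    _ ≤ ∫⁻ ξ in cube d, ‖F (cshift ξ ν) * char (-x) (cshift ξ ν)‖ₑ := by
      rw [one_mul]; exact enorm_integral_le_lintegral_enorm _
    _ = _ := by
      simp only [h2]
      rw [lintegral_const_mul' _ _ ENNReal.ofReal_ne_top]

/-! ### Convolution powers as Fourier coefficients -/

theorem coef_pow_trigSum {d : ℕ} {s : Finset (Fin d → ℤ)} {φ : (Fin d → ℤ) → ℂ}
    (hs : Function.support φ ⊆ s) (n : ℕ) (x : Fin d → ℤ) :
    coef (trigSum s φ ^ (n + 1)) x = convPow φ (n + 1) x := by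
  have htrig : trigSum s φ = ∑ y ∈ s, φ y • char y := by
    ext z; simp [trigSum]
  have hφ : ∀ y ∉ s, φ y = 0 := fun y hy => by
    by_contra h
    exact hy (hs h)
  induction n generalizing x with
  | zero =>
    rw [zero_add, pow_one, htrig, coef_sum _ fun i _ => Subalgebra.smul_mem _ (char_mem_trigPoly i) _]
    simp only [coef_smul, coef_char, mul_ite, mul_one, mul_zero, Finset.sum_ite_eq]
    split_ifs with h
    · rfl
    · exact (hφ x h).symm
  | succ n ih =>
    have hmem := Subalgebra.pow_mem _ (trigSum_mem_trigPoly s φ) (n + 1)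
    have e : trigSum s φ ^ (n + 1 + 1) =
        ∑ y ∈ s, φ y • (char y * trigSum s φ ^ (n + 1)) := by
      rw [pow_succ', htrig, Finset.sum_mul]
      simp only [smul_mul_assoc]
    rw [e, coef_sum _ fun i _ => Subalgebra.smul_mem _
      (Subalgebra.mul_mem _ (char_mem_trigPoly i) hmem) _]
    simp only [coef_smul, coef_char_mul, ih]
    change _ = ∑' y, convPow φ (n + 1) (x - y) * φ y
    rw [tsum_eq_sum (s := s) fun y hy => by rw [hφ y hy, mul_zero]]
    exact Finset.sum_congr rfl fun y _ => mul_comm _ _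

/-- The support grows linearly in `n`, so only bounded values of `(x - nα)/n` matter in the final
estimate. -/
theorem exists_support_convPow {d : ℕ} {s : Finset (Fin d → ℤ)} {φ : (Fin d → ℤ) → ℂ}
    (hs : Function.support φ ⊆ s) :
    ∃ L : ℝ, 0 ≤ L ∧ ∀ (n : ℕ) (x : Fin d → ℤ), convPow φ (n + 1) x ≠ 0 →
      ‖(fun j => (x j : ℝ))‖ ≤ (n + 1) * L := by
  set f : (Fin d → ℤ) → ℝ := fun x => ‖(fun j => (x j : ℝ))‖ with hf
  have hL : ∀ x ∈ s, f x ≤ ∑ x ∈ s, f x := fun x hx =>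
    Finset.single_le_sum (f := f) (fun _ _ => norm_nonneg _) hx
  refine ⟨∑ x ∈ s, f x, Finset.sum_nonneg fun _ _ => norm_nonneg _, fun n => ?_⟩
  induction n with
  | zero =>
    intro x hx
    simpa using hL x (hs hx)
  | succ n ih =>
    intro x hx
    change ∑' y, convPow φ (n + 1) (x - y) * φ y ≠ 0 at hx
    obtain ⟨y, hy⟩ : ∃ y, convPow φ (n + 1) (x - y) * φ y ≠ 0 := by
      by_contra! h
      exact hx (by simp [h])
    have h1 := ih _ (left_ne_zero_of_mul hy)
    have h2 := hL y (hs (right_ne_zero_of_mul hy))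
    have e : (fun j => (x j : ℝ)) = (fun j => (((x - y) j : ℤ) : ℝ)) + fun j => (y j : ℝ) := by
      ext j; simp
    rw [e]
    refine (norm_add_le _ _).trans ?_
    push_cast
    linarith

/-! ### Truncated binomial expansions -/

/-- The upper half of the binomial expansion of `(u + (1 - u)) ^ (2 * m)`. -/
def bern {A : Type*} [CommRing A] (m : ℕ) (u : A) : A :=
  ∑ j ∈ Finset.range (2 * m + 1) with m ≤ j, u ^ j * (1 - u) ^ (2 * m - j) * ((2 * m).choose j : A)

theorem one_sub_bern {A : Type*} [CommRing A] (m : ℕ) (u : A) :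
    1 - bern m u =
      ∑ j ∈ Finset.range (2 * m + 1) with ¬ m ≤ j,
        u ^ j * (1 - u) ^ (2 * m - j) * ((2 * m).choose j : A) := by
  have h := add_pow u (1 - u) (2 * m)
  rw [add_sub_cancel, one_pow, ← Finset.sum_filter_add_sum_filter_not _ (fun j => m ≤ j)] at h
  unfold bern
  rw [sub_eq_iff_eq_add', ← h]

theorem norm_bern_le (m : ℕ) (u : ℂ) : ‖bern m u‖ ≤ ((‖u‖ + ‖1 - u‖) ^ 2) ^ m := by
  unfold bern
  rw [← pow_mul, add_pow]
  refine (norm_sum_le _ _).trans ?_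
  refine (Finset.sum_le_sum_of_subset_of_nonneg (Finset.filter_subset _ _)
    fun _ _ _ => norm_nonneg _).trans (Finset.sum_le_sum fun j _ => ?_)
  simp

theorem sum_choose_filter_le (m : ℕ) (p : ℕ → Prop) [DecidablePred p] :
    ∑ j ∈ Finset.range (2 * m + 1) with p j, ((2 * m).choose j : ℝ) ≤ 4 ^ m := by
  refine (Finset.sum_le_sum_of_subset_of_nonneg (Finset.filter_subset _ _)
    fun _ _ _ => by positivity).trans (le_of_eq ?_)
  have := Nat.sum_range_choose (2 * m)
  rw [pow_mul] at this
  exact_mod_cast this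

/-- The small factor occurs at least `m` times and the other at most `m` times, so the sum is at
most `16^(-m) · 2^m · 4^m`. The exponents are left general to cover both halves of the expansion. -/
theorem norm_sum_binomial_le {a b : ℂ} (ha : ‖a‖ ≤ 1 / 16) (hb : ‖b‖ ≤ 2) (m : ℕ)
    (p : ℕ → Prop) [DecidablePred p] (e f : ℕ → ℕ)
    (he : ∀ j ∈ Finset.range (2 * m + 1), p j → m ≤ e j ∧ f j ≤ m) :
    ‖∑ j ∈ Finset.range (2 * m + 1) with p j, a ^ e j * b ^ f j * ((2 * m).choose j : ℂ)‖ ≤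
      (1 / 2) ^ m := by
  calc _ ≤ ∑ j ∈ Finset.range (2 * m + 1) with p j, (1 / 8 : ℝ) ^ m * ((2 * m).choose j : ℝ) := by
        refine (norm_sum_le _ _).trans (Finset.sum_le_sum fun j hj => ?_)
        obtain ⟨hj1, hj2⟩ := Finset.mem_filter.1 hj
        obtain ⟨h1, h2⟩ := he j hj1 hj2
        rw [norm_mul, norm_mul, norm_pow, norm_pow, Complex.norm_natCast]
        refine mul_le_mul_of_nonneg_right ?_ (by positivity)
        have h3 : ‖a‖ ^ e j ≤ (1 / 16) ^ m :=
          (pow_le_pow_left₀ (norm_nonneg _) ha _).trans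
            (pow_le_pow_of_le_one (by norm_num) (by norm_num) h1)
        have h4 : ‖b‖ ^ f j ≤ 2 ^ m :=
          (pow_le_pow_left₀ (norm_nonneg _) hb _).trans (pow_le_pow_right₀ (by norm_num) h2)
        calc ‖a‖ ^ e j * ‖b‖ ^ f j ≤ (1 / 16) ^ m * 2 ^ m := by gcongr
          _ = (1 / 8) ^ m := by rw [← mul_pow]; norm_num
    _ ≤ (1 / 8 : ℝ) ^ m * 4 ^ m := by
        rw [← Finset.mul_sum]
        gcongr
        exact sum_choose_filter_le m p
    _ = (1 / 2) ^ m := by rw [← mul_pow]; norm_num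

theorem norm_bern_le_of_near_zero {u : ℂ} (hu : ‖u‖ ≤ 1 / 16) (m : ℕ) :
    ‖bern m u‖ ≤ (1 / 2) ^ m := by
  have hv : ‖1 - u‖ ≤ 2 := by
    have := norm_sub_le 1 u
    rw [norm_one] at this
    linarith
  refine norm_sum_binomial_le hu hv m (fun j => m ≤ j) (fun j => j) (fun j => 2 * m - j) ?_
  intro j _ hj
  omega

theorem norm_one_sub_bern_le_of_near_one {u : ℂ} (hu : ‖1 - u‖ ≤ 1 / 16) (m : ℕ) :
    ‖1 - bern m u‖ ≤ (1 / 2) ^ m := by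
  have hv : ‖u‖ ≤ 2 := by
    have := norm_sub_le 1 (1 - u)
    rw [norm_one, sub_sub_cancel] at this
    linarith
  rw [one_sub_bern]
  have := norm_sum_binomial_le hu hv m (fun j => ¬ m ≤ j) (fun j => 2 * m - j) (fun j => j) (by
    intro j _ hj
    omega)
  simpa only [mul_comm (u ^ _) _] using this

/-! ### Periodicity and separation of points by trigonometric polynomials -/

theorem trigPoly_add_period {d : ℕ} {F : (Fin d → ℂ) → ℂ} (hF : F ∈ trigPoly d)
    (k : Fin d → ℤ) (ξ ν : Fin d → ℝ) :
    F (cshift (fun j => ξ j + k j * (2 * Real.pi)) ν) = F (cshift ξ ν) := by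
  refine trigPoly_induction (p := fun F => F (cshift (fun j => ξ j + k j * (2 * Real.pi)) ν) =
    F (cshift ξ ν)) (fun x => char_add_period x k ξ ν) rfl ?_ ?_ hF
  · intro F G h1 h2
    rw [Pi.add_apply, Pi.add_apply, h1, h2]
  · intro c F h
    rw [Pi.smul_apply, Pi.smul_apply, h]

/-- In a coordinate `i` where `a` and `b` differ, so do `exp (i a_i)` and `exp (i b_i)`, because the
torus is half-open; an affine function of that character separates the points. -/
theorem exists_separating_pair {d : ℕ} {a b : Fin d → ℝ} (ha : a ∈ torus d) (hb : b ∈ torus d)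
    (hab : a ≠ b) : ∃ h ∈ trigPoly d, h (cshift a 0) = 1 ∧ h (cshift b 0) = 0 := by
  obtain ⟨i, hi⟩ := Function.ne_iff.1 hab
  set e : (Fin d → ℂ) → ℂ := char (Pi.single i 1) with he
  have hval : ∀ ξ : Fin d → ℝ, e (cshift ξ 0) = Complex.exp (Complex.I * ξ i) := by
    intro ξ
    rw [he, char]
    congr 2
    rw [Finset.sum_eq_single i]
    · simp
    · intro j _ hj
      simp [hj]
    · simp
  have hne : e (cshift a 0) - e (cshift b 0) ≠ 0 := by
    rw [hval, hval, sub_ne_zero]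
    intro h
    obtain ⟨n, hn⟩ := Complex.exp_eq_exp_iff_exists_int.1 h
    have h2 : Complex.I * (a i : ℂ) = Complex.I * ((b i + n * (2 * Real.pi) : ℝ) : ℂ) := by
      rw [hn]; push_cast; ring
    have h3 : a i = b i + n * (2 * Real.pi) := by
      exact_mod_cast mul_left_cancel₀ Complex.I_ne_zero h2
    have ha' := ha i (Set.mem_univ i)
    have hb' := hb i (Set.mem_univ i)
    have hpi := Real.pi_pos
    have h4 : (n : ℝ) < 1 := by nlinarith [ha'.2, hb'.1]
    have h5 : (-1 : ℝ) < n := by nlinarith [ha'.1, hb'.2]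
    have h6 : n < 1 := by exact_mod_cast h4
    have h7 : -1 < n := by exact_mod_cast h5
    have h8 : n = 0 := by omega
    exact hi (by simpa [h8] using h3)
  refine ⟨(e (cshift a 0) - e (cshift b 0))⁻¹ • (e - algebraMap ℂ _ (e (cshift b 0))),
    Subalgebra.smul_mem _ (Subalgebra.sub_mem _ (char_mem_trigPoly _)
      (Subalgebra.algebraMap_mem _ _)) _, ?_, ?_⟩
  · exact inv_mul_cancel₀ hne
  · exact mul_eq_zero_of_right _ (sub_self _)

theorem exists_separating {d : ℕ} (t : Finset (Fin d → ℝ)) (ht : ∀ a ∈ t, a ∈ torus d) :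
    ∃ q : (Fin d → ℝ) → (Fin d → ℂ) → ℂ, ∀ a ∈ t, q a ∈ trigPoly d ∧ q a (cshift a 0) = 1 ∧
      ∀ b ∈ t, b ≠ a → q a (cshift b 0) = 0 := by
  classical
  have h : ∀ a b : Fin d → ℝ, ∃ h : (Fin d → ℂ) → ℂ, a ∈ t → b ∈ t → a ≠ b →
      h ∈ trigPoly d ∧ h (cshift a 0) = 1 ∧ h (cshift b 0) = 0 := by
    intro a b
    by_cases hab : a ∈ t ∧ b ∈ t ∧ a ≠ b
    · obtain ⟨h, hh⟩ := exists_separating_pair (ht a hab.1) (ht b hab.2.1) hab.2.2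
      exact ⟨h, fun _ _ _ => hh⟩
    · exact ⟨0, fun h1 h2 h3 => absurd ⟨h1, h2, h3⟩ hab⟩
  choose h hh using h
  refine ⟨fun a => ∏ b ∈ t.erase a, h a b, fun a ha => ⟨?_, ?_, ?_⟩⟩
  · refine Subalgebra.prod_mem _ fun b hb => ?_
    rw [Finset.mem_erase] at hb
    exact (hh a b ha hb.2 hb.1.symm).1
  · simp only [Finset.prod_apply]
    refine Finset.prod_eq_one fun b hb => ?_
    rw [Finset.mem_erase] at hb
    exact (hh a b ha hb.2 hb.1.symm).2.1
  · intro b hb hba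
    simp only [Finset.prod_apply]
    exact Finset.prod_eq_zero (Finset.mem_erase.2 ⟨hba, hb⟩) (hh a b ha hb hba.symm).2.2

theorem bern_comp_mem_trigPoly {d : ℕ} {q : (Fin d → ℂ) → ℂ} (hq : q ∈ trigPoly d) (m : ℕ) :
    bern m q ∈ trigPoly d := by
  unfold bern
  refine Subalgebra.sum_mem _ fun j _ => Subalgebra.mul_mem _ (Subalgebra.mul_mem _
    (Subalgebra.pow_mem _ hq _)
    (Subalgebra.pow_mem _ (Subalgebra.sub_mem _ (Subalgebra.one_mem _) hq) _))
    (natCast_mem _ _)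

theorem bern_apply {d : ℕ} (q : (Fin d → ℂ) → ℂ) (m : ℕ) (z : Fin d → ℂ) :
    bern m q z = bern m (q z) := by
  simp [bern, Finset.sum_apply]

/-- A partition of unity by trigonometric polynomials, of degree proportional to `m`, that are
exponentially small near all but one of the given points and grow at most exponentially
elsewhere. -/
theorem exists_weights {d : ℕ} (t : Finset (Fin d → ℝ)) (ht : ∀ a ∈ t, a ∈ torus d)
    (hne : t.Nonempty) :
    ∃ W : (Fin d → ℝ) → ℕ → (Fin d → ℂ) → ℂ,
      (∀ a ∈ t, ∀ m, W a m ∈ trigPoly d) ∧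
      (∀ m, ∑ a ∈ t, W a m = 1) ∧
      (∀ p : Fin d → ℝ, ∃ A B : ℝ, 1 ≤ A ∧ 1 ≤ B ∧
        ∀ᶠ x : (Fin d → ℝ) × (Fin d → ℝ) in 𝓝 (p, 0), ∀ a ∈ t, ∀ m,
          ‖W a m (cshift x.1 x.2)‖ ≤ A * B ^ m) ∧
      ∃ A : ℝ, 1 ≤ A ∧ ∀ a ∈ t, ∀ k : Fin d → ℤ,
        ∀ᶠ x : (Fin d → ℝ) × (Fin d → ℝ) in 𝓝 (fun j => a j + k j * (2 * Real.pi), 0), ∀ m,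
          ‖W a m (cshift x.1 x.2)‖ ≤ A ∧
          ∀ b ∈ t, b ≠ a → ‖W b m (cshift x.1 x.2)‖ ≤ A * (1 / 2) ^ m := by
  classical
  obtain ⟨a₀, ha₀⟩ := hne
  obtain ⟨q, hq⟩ := exists_separating t ht
  have hqc : ∀ a ∈ t, Continuous fun x : (Fin d → ℝ) × (Fin d → ℝ) => q a (cshift x.1 x.2) :=
    fun a ha => (continuous_of_mem_trigPoly (hq a ha).1).comp continuous_cshift
  set K : ℝ := (t.card : ℝ) with hK
  have hK0 : 0 ≤ K := by positivity
  have hcard : ((t.erase a₀).card : ℝ) ≤ K :=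
    Nat.cast_le.2 (Finset.card_le_card (t.erase_subset a₀))
  -- One weight is defined as the complement of the others, so that the sum is exactly one and not
  -- merely close to it.
  refine ⟨fun a m => if a = a₀ then 1 - ∑ b ∈ t.erase a₀, bern m (q b) else bern m (q a),
    ?_, ?_, ?_, 1 + K + 1, by linarith, ?_⟩
  · intro a ha m
    simp only
    split_ifs
    · exact Subalgebra.sub_mem _ (Subalgebra.one_mem _) (Subalgebra.sum_mem _ fun b hb =>
        bern_comp_mem_trigPoly (hq b (Finset.mem_of_mem_erase hb)).1 m)
    · exact bern_comp_mem_trigPoly (hq a ha).1 m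
  · intro m
    rw [← Finset.add_sum_erase t _ ha₀]
    simp only [if_true]
    rw [Finset.sum_congr rfl fun b hb => if_neg (Finset.ne_of_mem_erase hb)]
    exact sub_add_cancel _ _
  · intro p
    set B : ℝ := ∑ a ∈ t, ((‖q a (cshift p 0)‖ + ‖1 - q a (cshift p 0)‖) + 1) ^ 2 + 1 with hB
    have hB1 : 1 ≤ B := by
      have : 0 ≤ ∑ a ∈ t, ((‖q a (cshift p 0)‖ + ‖1 - q a (cshift p 0)‖) + 1) ^ 2 := by positivity
      linarith
    refine ⟨1 + K, B, by linarith, hB1, ?_⟩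
    have hev : ∀ᶠ x : (Fin d → ℝ) × (Fin d → ℝ) in 𝓝 (p, 0), ∀ a ∈ t,
        ‖q a (cshift x.1 x.2)‖ + ‖1 - q a (cshift x.1 x.2)‖ <
          (‖q a (cshift p 0)‖ + ‖1 - q a (cshift p 0)‖) + 1 := by
      rw [Filter.eventually_all_finset]
      intro a ha
      have hc := hqc a ha
      have : Continuous fun x : (Fin d → ℝ) × (Fin d → ℝ) =>
          ‖q a (cshift x.1 x.2)‖ + ‖1 - q a (cshift x.1 x.2)‖ :=
        hc.norm.add (continuous_const.sub hc).norm
      exact this.continuousAt.eventually_lt continuousAt_const (by simp)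
    filter_upwards [hev] with x hx a ha m
    have hb : ∀ b ∈ t, ‖bern m (q b) (cshift x.1 x.2)‖ ≤ B ^ m := by
      intro b hb
      rw [bern_apply]
      refine (norm_bern_le _ _).trans (pow_le_pow_left₀ (by positivity) ?_ m)
      refine (pow_le_pow_left₀ (by positivity) (hx b hb).le 2).trans ?_
      have := Finset.single_le_sum (f := fun a =>
        ((‖q a (cshift p 0)‖ + ‖1 - q a (cshift p 0)‖) + 1) ^ 2) (fun _ _ => by positivity) hb
      linarith
    have hBm : 1 ≤ B ^ m := one_le_pow₀ hB1
    split_ifs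
    · rw [Pi.sub_apply, Pi.one_apply, Finset.sum_apply]
      refine (norm_sub_le _ _).trans ?_
      rw [norm_one]
      have h1 : ‖∑ b ∈ t.erase a₀, bern m (q b) (cshift x.1 x.2)‖ ≤ (t.erase a₀).card * B ^ m := by
        refine (norm_sum_le _ _).trans ((Finset.sum_le_sum fun b hb' =>
          hb b (Finset.mem_of_mem_erase hb')).trans (by simp))
      nlinarith
    · have := hb a ha
      nlinarith
  · intro a ha k
    have hev : ∀ᶠ x : (Fin d → ℝ) × (Fin d → ℝ) in 𝓝 (fun j => a j + k j * (2 * Real.pi), 0),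
        ∀ b ∈ t, ‖q b (cshift x.1 x.2) - q b (cshift a 0)‖ < 1 / 16 := by
      rw [Filter.eventually_all_finset]
      intro b hb
      have hc := hqc b hb
      have : Continuous fun x : (Fin d → ℝ) × (Fin d → ℝ) =>
          ‖q b (cshift x.1 x.2) - q b (cshift a 0)‖ :=
        (hc.sub continuous_const).norm
      refine this.continuousAt.eventually_lt continuousAt_const ?_
      rw [trigPoly_add_period (hq b hb).1, sub_self, norm_zero]
      norm_num
    filter_upwards [hev] with x hx m
    have hfar : ∀ b ∈ t, b ≠ a → ‖bern m (q b) (cshift x.1 x.2)‖ ≤ (1 / 2) ^ m := by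
      intro b hb hba
      rw [bern_apply]
      refine norm_bern_le_of_near_zero ?_ m
      have := hx b hb
      rw [(hq b hb).2.2 a ha hba.symm, sub_zero] at this
      exact this.le
    have hclose : ‖1 - bern m (q a) (cshift x.1 x.2)‖ ≤ (1 / 2) ^ m := by
      rw [bern_apply]
      refine norm_one_sub_bern_le_of_near_one ?_ m
      have := hx a ha
      rw [(hq a ha).2.1, norm_sub_rev] at this
      exact this.le
    have hhalf0 : (0 : ℝ) ≤ (1 / 2) ^ m := by positivity
    have hhalf1 : (1 / 2 : ℝ) ^ m ≤ 1 := pow_le_one₀ (by norm_num) (by norm_num)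
    have hsumle : ∀ u ⊆ t.erase a, ‖∑ b ∈ u, bern m (q b) (cshift x.1 x.2)‖ ≤ K * (1 / 2) ^ m := by
      intro u hu
      have h1 : ‖∑ b ∈ u, bern m (q b) (cshift x.1 x.2)‖ ≤ u.card * (1 / 2) ^ m := by
        refine (norm_sum_le _ _).trans ((Finset.sum_le_sum fun b hb =>
          hfar b (Finset.mem_of_mem_erase (hu hb)) (Finset.ne_of_mem_erase (hu hb))).trans (by simp))
      have h2 : (u.card : ℝ) ≤ K :=
        Nat.cast_le.2 (Finset.card_le_card (hu.trans (t.erase_subset a)))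
      exact h1.trans (by gcongr)
    by_cases haa : a = a₀
    · subst haa
      refine ⟨?_, fun b hb hba => ?_⟩
      · simp only [if_true]
        rw [Pi.sub_apply, Pi.one_apply, Finset.sum_apply]
        refine (norm_sub_le _ _).trans ?_
        rw [norm_one]
        have := hsumle _ subset_rfl
        nlinarith
      · simp only [if_neg hba]
        have := hfar b hb hba
        nlinarith
    · refine ⟨?_, fun b hb hba => ?_⟩
      · simp only [if_neg haa]
        have h1 := norm_sub_norm_le (bern m (q a) (cshift x.1 x.2)) 1
        rw [norm_one, norm_sub_rev] at h1
        linarith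
      · by_cases hb0 : b = a₀
        · simp only [if_pos hb0]
          -- Near `a ≠ a₀` the complementary weight is `1 - bern m (q a)` minus the remaining terms,
          -- and each of these is `O(2^(-m))`.
          rw [Pi.sub_apply, Pi.one_apply, Finset.sum_apply,
            ← Finset.add_sum_erase _ _ (Finset.mem_erase.2 ⟨haa, ha⟩), ← sub_sub]
          refine (norm_sub_le _ _).trans ?_
          have := hsumle ((t.erase a₀).erase a) (Finset.erase_subset_erase _ (t.erase_subset a₀))
          nlinarith
        · simp only [if_neg hb0]
          have := hfar b hb hba
          nlinarith

/-! ### The set where the Fourier transform has modulus one -/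

theorem exists_period_mem_torus {d : ℕ} (ξ : Fin d → ℝ) :
    ∃ k : Fin d → ℤ, (fun j => ξ j + k j * (2 * Real.pi)) ∈ torus d := by
  refine ⟨fun j => -toIocDiv Real.two_pi_pos (-Real.pi) (ξ j), fun j _ => ?_⟩
  have h := sub_toIocDiv_zsmul_mem_Ioc Real.two_pi_pos (-Real.pi) (ξ j)
  rw [zsmul_eq_mul, show -Real.pi + 2 * Real.pi = Real.pi by ring] at h
  push_cast
  rwa [neg_mul, ← sub_eq_add_neg]

section

variable {d : ℕ} {s : Finset (Fin d → ℤ)} {φ : (Fin d → ℤ) → ℂ}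

theorem norm_trigSum_real_le_one (hs : Function.support φ ⊆ s) (hnorm : IsNormalized φ)
    (ξ : Fin d → ℝ) : ‖trigSum s φ (cshift ξ 0)‖ ≤ 1 := by
  obtain ⟨k, hk⟩ := exists_period_mem_torus ξ
  have := hnorm.1 ⟨_, hk, rfl⟩
  simp only [fourier_eq_trigSum hs] at this
  rwa [trigSum_add_period] at this

theorem exists_mem_Omega (hs : Function.support φ ⊆ s) {p : Fin d → ℝ}
    (hp : ‖trigSum s φ (cshift p 0)‖ = 1) :
    ∃ a ∈ Omega φ, ∃ k : Fin d → ℤ, p = fun j => a j + k j * (2 * Real.pi) := by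
  obtain ⟨k, hk⟩ := exists_period_mem_torus p
  refine ⟨_, ⟨hk, ?_⟩, fun j => -k j, ?_⟩
  · rw [fourier_eq_trigSum hs, trigSum_add_period, hp]
  · ext j
    push_cast
    ring

theorem continuous_trigSum_real (s : Finset (Fin d → ℤ)) (φ : (Fin d → ℤ) → ℂ) :
    Continuous fun ξ : Fin d → ℝ => ‖trigSum s φ (cshift ξ 0)‖ := by
  refine ((continuous_trigSum s φ).comp ?_).norm
  unfold cshift; fun_prop

/-- The maximum is attained on the closed cube; periodicity moves the maximiser into the half-open
torus. -/
theorem Omega_nonempty (hs : Function.support φ ⊆ s) (hnorm : IsNormalized φ) :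
    (Omega φ).Nonempty := by
  have hne : (cube d).Nonempty := ⟨0, fun j _ => ⟨by simp [Real.pi_pos.le], Real.pi_pos.le⟩⟩
  obtain ⟨p, -, hmax⟩ := (isCompact_cube d).exists_isMaxOn hne
    (continuous_trigSum_real s φ).continuousOn
  have hge : 1 ≤ ‖trigSum s φ (cshift p 0)‖ := by
    refine hnorm.2 ?_
    rintro _ ⟨ξ, hξ, rfl⟩
    simp only [fourier_eq_trigSum hs]
    exact hmax fun j hj => Set.Ioc_subset_Icc_self (hξ j hj)
  obtain ⟨a, ha, -⟩ := exists_mem_Omega hs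
    (le_antisymm (norm_trigSum_real_le_one hs hnorm p) hge)
  exact ⟨a, ha⟩

/-- Near a point of modulus one the local bound with `ν = 0` is `exp (-R/2)`, which is below one
except at that point. Such points are isolated, and compactness finishes. -/
theorem Omega_finite (hs : Function.support φ ⊆ s)
    (hnorm : IsNormalized φ)
    (htype : ∀ ξ ∈ Omega φ, ∃ α P, IsPosHomType φ ξ α P) : (Omega φ).Finite := by
  suffices h : {ξ ∈ cube d | ‖trigSum s φ (cshift ξ 0)‖ = 1}.Finite by
    refine h.subset fun ξ hξ => ⟨fun j hj => Set.Ioc_subset_Icc_self (hξ.1 j hj), ?_⟩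
    rw [← fourier_eq_trigSum hs]; exact hξ.2
  refine (isCompact_cube d).induction_on
    (p := fun S => {ξ ∈ S | ‖trigSum s φ (cshift ξ 0)‖ = 1}.Finite) (by simp) ?_ ?_ ?_
  · exact fun S T hST hT => hT.subset fun ξ hξ => ⟨hST hξ.1, hξ.2⟩
  · intro S T hS hT
    refine (hS.union hT).subset ?_
    rintro ξ ⟨h1 | h1, h2⟩
    · exact Or.inl ⟨h1, h2⟩
    · exact Or.inr ⟨h1, h2⟩
  · intro p _
    rcases (norm_trigSum_real_le_one hs hnorm p).lt_or_eq with hlt | heq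
    · refine ⟨{ξ | ‖trigSum s φ (cshift ξ 0)‖ < 1}, mem_nhdsWithin_of_mem_nhds
        ((continuous_trigSum_real s φ).continuousAt.eventually_lt continuousAt_const hlt), ?_⟩
      convert Set.finite_empty using 1
      ext ξ
      simp only [Set.mem_ofPred_eq, Set.mem_empty_iff_false, iff_false, not_and]
      exact fun h => h.ne
    · obtain ⟨a, ha, k, rfl⟩ := exists_mem_Omega hs heq
      obtain ⟨α, P, h⟩ := htype a ha
      obtain ⟨M, ρ, hM, hρ, hbound⟩ := h.norm_trigSum_le hs ha.2
      set p : Fin d → ℝ := fun j => a j + k j * (2 * Real.pi) with hp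
      refine ⟨Metric.ball p ρ, mem_nhdsWithin_of_mem_nhds (Metric.ball_mem_nhds _ hρ), ?_⟩
      refine (Set.finite_singleton p).subset ?_
      rintro ξ ⟨h1, h2⟩
      have e : ξ = fun j => (a + (ξ - p)) j + k j * (2 * Real.pi) := by
        ext j
        simp only [hp, Pi.add_apply, Pi.sub_apply]
        ring
      have h3 := hbound (ξ - p) 0 (by rw [← dist_eq_norm]; exact (Metric.mem_ball.1 h1).le)
        (by simpa using hρ.le)
      rw [e, trigSum_add_period] at h2
      rw [h2, h.1.rePoly_zero, dotProduct_zero, mul_zero, add_zero, zero_sub, Real.one_le_exp_iff]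
        at h3
      have h4 := h.1.nonneg (ξ - p)
      exact sub_eq_zero.1 ((h.1.2 (ξ - p)).2 (by linarith))

end

/-! ### Local integral bounds -/

theorem exists_exp_neg_le (μ : ℝ) {δ : ℝ} (hδ : 0 < δ) :
    ∃ C : ℝ, 0 < C ∧ ∀ n : ℕ, 1 ≤ n → Real.exp (-(δ * n)) ≤ C / (n : ℝ) ^ μ := by
  have h := (tendsto_rpow_mul_exp_neg_mul_atTop_nhds_zero μ δ hδ).comp
    (tendsto_natCast_atTop_atTop (R := ℝ))
  obtain ⟨C, hC⟩ := h.bddAbove_range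
  refine ⟨max C 1, by positivity, fun n hn => ?_⟩
  have hn0 : (0 : ℝ) < n := by exact_mod_cast hn
  rw [le_div_iff₀ (Real.rpow_pos_of_pos hn0 _), mul_comm]
  refine le_max_of_le_left (le_trans (le_of_eq ?_) (hC ⟨n, rfl⟩))
  simp

/-- The family `G n ξ ν` has Gaussian-type integrals over `S`, for small imaginary parts `ν`. -/
def GaussianOn {d : ℕ} (G : ℕ → (Fin d → ℝ) → (Fin d → ℝ) → ℂ) (α : Fin d → ℝ)
    (R : (Fin d → ℝ) → ℝ) (μ : ℝ) (S : Set (Fin d → ℝ)) : Prop :=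
  ∃ ρ C M : ℝ, 0 < ρ ∧ 0 < C ∧ 0 < M ∧ ∀ n : ℕ, 1 ≤ n → ∀ ν : Fin d → ℝ, ‖ν‖ ≤ ρ →
    ∫⁻ ξ in S, ‖G n ξ ν‖ₑ ≤
      ENNReal.ofReal (C / (n : ℝ) ^ μ * Real.exp (n * (α ⬝ᵥ ν + M * R ν)))

section

variable {d : ℕ} {G : ℕ → (Fin d → ℝ) → (Fin d → ℝ) → ℂ} {α : Fin d → ℝ}
  {R : (Fin d → ℝ) → ℝ} {μ : ℝ}

theorem GaussianOn.empty : GaussianOn G α R μ ∅ :=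
  ⟨1, 1, 1, one_pos, one_pos, one_pos, fun n _ ν _ => by simp⟩

theorem GaussianOn.mono {S T : Set (Fin d → ℝ)} (hST : S ⊆ T) (h : GaussianOn G α R μ T) :
    GaussianOn G α R μ S := by
  obtain ⟨ρ, C, M, hρ, hC, hM, h⟩ := h
  exact ⟨ρ, C, M, hρ, hC, hM, fun n hn ν hν => (lintegral_mono_set hST).trans (h n hn ν hν)⟩

theorem GaussianOn.union (hR : ∀ ξ, 0 ≤ R ξ) {S T : Set (Fin d → ℝ)}
    (hS : GaussianOn G α R μ S) (hT : GaussianOn G α R μ T) : GaussianOn G α R μ (S ∪ T) := by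
  obtain ⟨ρ, C, M, hρ, hC, hM, h⟩ := hS
  obtain ⟨ρ', C', M', hρ', hC', hM', h'⟩ := hT
  refine ⟨min ρ ρ', C + C', max M M', by positivity, by positivity, by positivity,
    fun n hn ν hν => ?_⟩
  have hn0 : (0 : ℝ) < n := by exact_mod_cast hn
  have hp : (0 : ℝ) < (n : ℝ) ^ μ := Real.rpow_pos_of_pos hn0 _
  refine (lintegral_union_le _ _ _).trans ((add_le_add (h n hn ν (hν.trans (min_le_left _ _)))
    (h' n hn ν (hν.trans (min_le_right _ _)))).trans ?_)
  have hRν := hR ν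
  rw [add_div, add_mul, ENNReal.ofReal_add (by positivity) (by positivity)]
  gcongr
  · exact le_max_left _ _
  · exact le_max_right _ _

/-- A family that decays exponentially satisfies the Gaussian-type bounds. -/
theorem GaussianOn.of_exp_decay (hR : ∀ ξ, 0 ≤ R ξ) {S : Set (Fin d → ℝ)}
    (hS : MeasurableSet S) (hvol : volume S < ⊤) {A δ ρ : ℝ} (hA : 0 < A) (hδ : 0 < δ) (hρ : 0 < ρ)
    (hG : ∀ n : ℕ, 1 ≤ n → ∀ ξ ∈ S, ∀ ν : Fin d → ℝ, ‖ν‖ ≤ ρ →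
      ‖G n ξ ν‖ ≤ A * Real.exp (-(2 * δ * n))) : GaussianOn G α R μ S := by
  obtain ⟨C, hC, hexp⟩ := exists_exp_neg_le μ hδ
  have hcont : Continuous fun ν : Fin d → ℝ => α ⬝ᵥ ν := by
    simp only [dotProduct]; fun_prop
  -- The decay `exp (-2δn)` is split in two: one `exp (-δn)` beats `n^(-μ)`, the other is at most
  -- `exp (n α·ν)` once `α·ν > -δ`.
  have hev : ∀ᶠ ν in 𝓝 (0 : Fin d → ℝ), -δ < α ⬝ᵥ ν :=
    continuousAt_const.eventually_lt hcont.continuousAt (by simpa using hδ)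
  obtain ⟨η, hη, hball⟩ := Metric.eventually_nhds_iff.1 hev
  refine ⟨min ρ (η / 2), A * C * (volume.real S + 1), 1, by positivity, by positivity, one_pos,
    fun n hn ν hν => ?_⟩
  have hn0 : (0 : ℝ) < n := by exact_mod_cast hn
  have hp : (0 : ℝ) < (n : ℝ) ^ μ := Real.rpow_pos_of_pos hn0 _
  have hν1 : -δ < α ⬝ᵥ ν := hball (by
    rw [dist_zero_right]
    linarith [hν.trans (min_le_right _ _)])
  have hRν := hR ν
  calc ∫⁻ ξ in S, ‖G n ξ ν‖ₑ ≤ ∫⁻ _ξ in S, ENNReal.ofReal (A * Real.exp (-(2 * δ * n))) := by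
        refine setLIntegral_mono' hS fun ξ hξ => ?_
        rw [← ofReal_norm]
        exact ENNReal.ofReal_le_ofReal (hG n hn ξ hξ ν (hν.trans (min_le_left _ _)))
    _ = ENNReal.ofReal (A * Real.exp (-(2 * δ * n)) * volume.real S) := by
        rw [lintegral_const, Measure.restrict_apply_univ, ENNReal.ofReal_mul (p := A * _) (by positivity),
          Measure.real, ENNReal.ofReal_toReal hvol.ne]
    _ ≤ _ := by
        refine ENNReal.ofReal_le_ofReal ?_
        have e : Real.exp (-(2 * δ * n)) = Real.exp (-(δ * n)) * Real.exp (n * -δ) := by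
          rw [← Real.exp_add]; congr 1; ring
        have h1 : Real.exp (n * -δ) ≤ Real.exp (n * (α ⬝ᵥ ν + 1 * R ν)) := by
          gcongr; linarith
        have h2 := hexp n hn
        have hv : 0 ≤ volume.real S := measureReal_nonneg
        calc A * Real.exp (-(2 * δ * n)) * volume.real S
            = A * (Real.exp (-(δ * n)) * Real.exp (n * -δ)) * volume.real S := by rw [e]
          _ ≤ A * (C / (n : ℝ) ^ μ * Real.exp (n * (α ⬝ᵥ ν + 1 * R ν))) * (volume.real S + 1) := by
            gcongr
            linarith
          _ = _ := by ring

end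

theorem exists_ball_of_eventually_prod {d : ℕ} {p : Fin d → ℝ}
    {Q : (Fin d → ℝ) × (Fin d → ℝ) → Prop} (h : ∀ᶠ x in 𝓝 (p, (0 : Fin d → ℝ)), Q x) :
    ∃ r : ℝ, 0 < r ∧ ∀ ξ ∈ Metric.ball p r, ∀ ν : Fin d → ℝ, ‖ν‖ ≤ r → Q (ξ, ν) := by
  obtain ⟨r, hr, hball⟩ := Metric.eventually_nhds_iff.1 h
  refine ⟨r / 2, by positivity, fun ξ hξ ν hν => hball ?_⟩
  rw [Prod.dist_eq, dist_zero_right]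
  rw [Metric.mem_ball] at hξ
  exact max_lt (by simp only; linarith) (by simp only; linarith)

/-- After translation by `p` and scaling by `n^E`, the integral of `exp (-nR/2)` contributes `n^(-tr
E)` times a finite constant; the factor depending on `ν` comes out. -/
theorem GaussianOn.of_norm_le {d : ℕ} {G : ℕ → (Fin d → ℝ) → (Fin d → ℝ) → ℂ} {α : Fin d → ℝ}
    {P : MvPolynomial (Fin d) ℂ} (hP : IsPositiveHomogeneous P)
    {E : Matrix (Fin d) (Fin d) ℝ} (hE : E ∈ exponentSet (rePoly P)) {p : Fin d → ℝ}
    {S : Set (Fin d → ℝ)} (hS : MeasurableSet S) {A M ρ : ℝ} (hA : 0 < A) (hM : 0 < M) (hρ : 0 < ρ)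
    (hG : ∀ n : ℕ, 1 ≤ n → ∀ ξ ∈ S, ∀ ν : Fin d → ℝ, ‖ν‖ ≤ ρ →
      ‖G n ξ ν‖ ≤ A * Real.exp (α ⬝ᵥ ν - rePoly P (ξ - p) / 2 + M * rePoly P ν) ^ n) :
    GaussianOn G α (rePoly P) E.trace S := by
  have hI := hP.lintegral_exp_neg_lt_top (c := 1 / 2) (by norm_num)
  set I := ∫⁻ ξ : Fin d → ℝ, ENNReal.ofReal (Real.exp (-(1 / 2 * rePoly P ξ))) with hIdef
  refine ⟨ρ, A * (I.toReal + 1), M, hρ, by positivity, hM, fun n hn ν hν => ?_⟩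
  have hn0 : (0 : ℝ) < n := by exact_mod_cast hn
  have hp : (0 : ℝ) < (n : ℝ) ^ E.trace := Real.rpow_pos_of_pos hn0 _
  set a : ℝ := A * Real.exp (n * (α ⬝ᵥ ν + M * rePoly P ν)) with ha
  have ha0 : 0 ≤ a := by positivity
  calc ∫⁻ ξ in S, ‖G n ξ ν‖ₑ
      ≤ ∫⁻ ξ in S, ENNReal.ofReal a *
          ENNReal.ofReal (Real.exp (-(n * (1 / 2 * rePoly P (ξ - p))))) := by
        refine setLIntegral_mono' hS fun ξ hξ => ?_
        rw [← ofReal_norm, ← ENNReal.ofReal_mul ha0]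
        refine ENNReal.ofReal_le_ofReal ((hG n hn ξ hξ ν hν).trans (le_of_eq ?_))
        rw [ha, mul_assoc, ← Real.exp_add, ← Real.exp_nat_mul]
        congr 2
        ring
    _ ≤ ∫⁻ ξ : Fin d → ℝ, ENNReal.ofReal a *
          ENNReal.ofReal (Real.exp (-(n * (1 / 2 * rePoly P (ξ - p))))) := setLIntegral_le_lintegral _ _
    _ = ENNReal.ofReal a * (ENNReal.ofReal (((n : ℝ) ^ E.trace)⁻¹) * I) := by
        rw [lintegral_const_mul' _ _ ENNReal.ofReal_ne_top,
          lintegral_sub_right_eq_self (fun ξ : Fin d → ℝ =>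
            ENNReal.ofReal (Real.exp (-(n * (1 / 2 * rePoly P ξ))))) p,
          IsPositiveHomogeneous.lintegral_exp_neg_nsmul hE _ hn0]
    _ = ENNReal.ofReal (a * (((n : ℝ) ^ E.trace)⁻¹ * I.toReal)) := by
        rw [ENNReal.ofReal_mul ha0, ENNReal.ofReal_mul (p := (_ ^ _)⁻¹) (by positivity),
          ENNReal.ofReal_toReal hI.ne]
    _ ≤ _ := by
        refine ENNReal.ofReal_le_ofReal ?_
        rw [ha]
        have : A * Real.exp (n * (α ⬝ᵥ ν + M * rePoly P ν)) * (((n : ℝ) ^ E.trace)⁻¹ * I.toReal) =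
          A * I.toReal / (n : ℝ) ^ E.trace * Real.exp (n * (α ⬝ᵥ ν + M * rePoly P ν)) := by
          field_simp
        rw [this]
        gcongr
        linarith

section

variable {d : ℕ} {s : Finset (Fin d → ℤ)} {φ : (Fin d → ℤ) → ℂ} {w : ℕ → (Fin d → ℂ) → ℂ}

/-- Away from the points where the Fourier transform has modulus one. -/
theorem gaussianOn_of_norm_lt_one {p : Fin d → ℝ}
    (hp : ‖trigSum s φ (cshift p 0)‖ < 1) {A B : ℝ} (hA : 1 ≤ A) (hB : 1 ≤ B)
    (hw : ∀ᶠ x : (Fin d → ℝ) × (Fin d → ℝ) in 𝓝 (p, 0), ∀ m, ‖w m (cshift x.1 x.2)‖ ≤ A * B ^ m)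
    {α : Fin d → ℝ} {R : (Fin d → ℝ) → ℝ} (hR : ∀ ξ, 0 ≤ R ξ) (μ : ℝ) :
    ∃ S ∈ 𝓝 p, ∃ L₀ : ℕ, ∀ L ≥ L₀,
      GaussianOn (fun n ξ ν => w (n / L) (cshift ξ ν) * trigSum s φ (cshift ξ ν) ^ n) α R μ S := by
  set c : ℝ := (1 + ‖trigSum s φ (cshift p 0)‖) / 2 with hc
  have hn := norm_nonneg (trigSum s φ (cshift p 0))
  have hc0 : 0 < c := by rw [hc]; positivity
  have hc1 : c < 1 := by rw [hc]; linarith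
  -- Here `c = exp (-3δ)`: one `δ` pays for the growth `B^(n/L) ≤ exp (δn)`, valid once `L ≥ log B /
  -- δ`, and two remain.
  set δ : ℝ := -Real.log c / 3 with hδ
  have hδ0 : 0 < δ := by
    have := Real.log_neg hc0 hc1
    rw [hδ]; linarith
  have hexp : Real.exp (-(3 * δ)) = c := by
    rw [hδ, show -(3 * (-Real.log c / 3)) = Real.log c by ring, Real.exp_log hc0]
  have hev : ∀ᶠ x : (Fin d → ℝ) × (Fin d → ℝ) in 𝓝 (p, 0), ‖trigSum s φ (cshift x.1 x.2)‖ < c := by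
    refine ((continuous_trigSum s φ).comp continuous_cshift).norm.continuousAt.eventually_lt
      continuousAt_const ?_
    simp only [Function.comp]
    rw [hc]; linarith
  obtain ⟨r, hr, hball⟩ := exists_ball_of_eventually_prod (hw.and hev)
  refine ⟨_, Metric.ball_mem_nhds p hr, ⌈Real.log B / δ⌉₊, fun L hL => ?_⟩
  refine GaussianOn.of_exp_decay hR Metric.isOpen_ball.measurableSet measure_ball_lt_top
    (A := A) (δ := δ) (ρ := r) (by linarith) hδ0 hr fun n _ ξ hξ ν hν => ?_
  obtain ⟨h1, h2⟩ := hball ξ hξ ν hν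
  have h3 : B ^ (n / L) ≤ Real.exp (δ * n) := by
    have hBl : 0 ≤ Real.log B := Real.log_nonneg hB
    rw [← Real.exp_log (show 0 < B by linarith), ← Real.exp_nat_mul, Real.exp_le_exp]
    -- For `L = 0` the natural-number quotient `n / L` is `0`.
    rcases Nat.eq_zero_or_pos L with rfl | hL0
    · simp only [Nat.div_zero, Nat.cast_zero, zero_mul]; positivity
    have hL' : Real.log B ≤ δ * L := by
      have := (Nat.le_ceil (Real.log B / δ)).trans (Nat.cast_le.2 hL)
      rw [div_le_iff₀ hδ0] at this
      linarith
    have hq : ((n / L : ℕ) : ℝ) * L ≤ n := by exact_mod_cast Nat.div_mul_le_self n L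
    calc ((n / L : ℕ) : ℝ) * Real.log B ≤ ((n / L : ℕ) : ℝ) * (δ * L) := by gcongr
      _ = δ * (((n / L : ℕ) : ℝ) * L) := by ring
      _ ≤ δ * n := by gcongr
  have h4 : ‖trigSum s φ (cshift ξ ν)‖ ^ n ≤ Real.exp (-(3 * δ)) ^ n := by
    rw [hexp]
    exact pow_le_pow_left₀ (norm_nonneg _) h2.le n
  rw [norm_mul, norm_pow]
  calc ‖w (n / L) (cshift ξ ν)‖ * ‖trigSum s φ (cshift ξ ν)‖ ^ n
      ≤ A * Real.exp (δ * n) * Real.exp (-(3 * δ)) ^ n := by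
        refine mul_le_mul ((h1 _).trans ?_) h4 (by positivity) (by positivity)
        gcongr
    _ = A * Real.exp (-(2 * δ * n)) := by
        rw [mul_assoc, ← Real.exp_nat_mul, ← Real.exp_add]
        congr 2; ring

/-- Near a point where the weight decays exponentially. -/
theorem gaussianOn_of_weight_decay (hle : ∀ ξ : Fin d → ℝ, ‖trigSum s φ (cshift ξ 0)‖ ≤ 1)
    {p : Fin d → ℝ} {A : ℝ} (hA : 1 ≤ A)
    (hw : ∀ᶠ x : (Fin d → ℝ) × (Fin d → ℝ) in 𝓝 (p, 0), ∀ m,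
      ‖w m (cshift x.1 x.2)‖ ≤ A * (1 / 2) ^ m)
    {α : Fin d → ℝ} {R : (Fin d → ℝ) → ℝ} (hR : ∀ ξ, 0 ≤ R ξ) (μ : ℝ) :
    ∃ S ∈ 𝓝 p, ∃ L₀ : ℕ, ∀ L ≥ L₀,
      GaussianOn (fun n ξ ν => w (n / L) (cshift ξ ν) * trigSum s φ (cshift ξ ν) ^ n) α R μ S := by
  obtain ⟨r, hr, hball⟩ := exists_ball_of_eventually_prod hw
  refine ⟨_, Metric.ball_mem_nhds p hr, 1, fun L hL => ?_⟩
  have hL0 : (0 : ℝ) < L := by exact_mod_cast hL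
  have hlog : 0 < Real.log 2 := Real.log_pos (by norm_num)
  -- Thus `2^(-n/L) = exp (-4δn)` for the real quotient; rounding down costs a factor `2`. Keeping
  -- `‖φ̂‖ ≤ exp (2δ)` by a small imaginary shift, whose size depends on `L`, leaves `exp (-2δn)`.
  set δ : ℝ := Real.log 2 / (4 * L) with hδ
  have hδ0 : 0 < δ := by positivity
  obtain ⟨ρ, hρ, hclose⟩ := exists_trigSum_cshift_sub_le s φ (ε := 2 * δ) (by positivity)
  refine GaussianOn.of_exp_decay hR Metric.isOpen_ball.measurableSet measure_ball_lt_top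
    (A := A * 2) (δ := δ) (ρ := min r ρ) (by linarith) hδ0 (by positivity) fun n _ ξ hξ ν hν => ?_
  have h1 := hball ξ hξ ν (hν.trans (min_le_left _ _)) (n / L)
  have h2 : ‖trigSum s φ (cshift ξ ν)‖ ≤ Real.exp (2 * δ) := by
    have h3 := hclose ξ ν (hν.trans (min_le_right _ _))
    have h4 := norm_le_norm_add_norm_sub' (trigSum s φ (cshift ξ ν)) (trigSum s φ (cshift ξ 0))
    have h5 := Real.add_one_le_exp (2 * δ)
    linarith [hle ξ]
  have h6 : (1 / 2 : ℝ) ^ (n / L) ≤ 2 * Real.exp (-(4 * δ * n)) := by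
    have hq : (n : ℝ) ≤ (((n / L : ℕ) : ℝ) + 1) * L := by
      have := (Nat.lt_div_mul_add (a := n) hL).le
      have h : n ≤ (n / L + 1) * L := by linarith
      exact_mod_cast h
    have e1 : (1 / 2 : ℝ) ^ (n / L) = Real.exp (-(((n / L : ℕ) : ℝ) * Real.log 2)) := by
      rw [← mul_neg, Real.exp_nat_mul, Real.exp_neg, Real.exp_log (by norm_num), one_div]
    have e2 : 2 * Real.exp (-(4 * δ * n)) = Real.exp (Real.log 2 + -(4 * δ * n)) := by
      rw [Real.exp_add, Real.exp_log (by norm_num)]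
    rw [e1, e2, Real.exp_le_exp]
    have h7 : 4 * δ * n ≤ (((n / L : ℕ) : ℝ) + 1) * Real.log 2 := by
      calc 4 * δ * n ≤ 4 * δ * ((((n / L : ℕ) : ℝ) + 1) * L) := by gcongr
        _ = _ := by rw [hδ]; field_simp
    linarith
  rw [norm_mul, norm_pow]
  calc ‖w (n / L) (cshift ξ ν)‖ * ‖trigSum s φ (cshift ξ ν)‖ ^ n
      ≤ A * (2 * Real.exp (-(4 * δ * n))) * Real.exp (2 * δ) ^ n := by
        refine mul_le_mul (h1.trans ?_) (pow_le_pow_left₀ (norm_nonneg _) h2 n) (by positivity)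
          (by positivity)
        gcongr
    _ = A * 2 * Real.exp (-(2 * δ * n)) := by
        rw [← mul_assoc, mul_assoc (A * 2), ← Real.exp_nat_mul, ← Real.exp_add]
        congr 2; ring

/-- Near a point of positive-homogeneous type. -/
theorem gaussianOn_of_isPosHomType (hs : Function.support φ ⊆ s) {a α : Fin d → ℝ}
    {P : MvPolynomial (Fin d) ℂ} (h : IsPosHomType φ a α P) (ha : ‖fourier φ a‖ = 1)
    {μ : ℝ} (hμ : IsHomogeneousOrder (rePoly P) μ) {k : Fin d → ℤ} {A : ℝ} (hA : 1 ≤ A)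
    (hw : ∀ᶠ x : (Fin d → ℝ) × (Fin d → ℝ) in 𝓝 (fun j => a j + k j * (2 * Real.pi), 0), ∀ m,
      ‖w m (cshift x.1 x.2)‖ ≤ A) :
    ∃ S ∈ 𝓝 (fun j => a j + k j * (2 * Real.pi)), ∃ L₀ : ℕ, ∀ L ≥ L₀,
      GaussianOn (fun n ξ ν => w (n / L) (cshift ξ ν) * trigSum s φ (cshift ξ ν) ^ n) α
        (rePoly P) μ S := by
  obtain ⟨E, hE, rfl⟩ := hμ
  obtain ⟨r, hr, hball⟩ := exists_ball_of_eventually_prod hw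
  obtain ⟨M, ρ, hM, hρ, hbound⟩ := h.norm_trigSum_le hs ha
  set p : Fin d → ℝ := fun j => a j + k j * (2 * Real.pi) with hp
  refine ⟨Metric.ball p (min r ρ), Metric.ball_mem_nhds p (by positivity), 0, fun L _ => ?_⟩
  refine GaussianOn.of_norm_le h.1 hE (p := p) Metric.isOpen_ball.measurableSet (A := A) (M := M)
    (ρ := min r ρ) (by linarith) hM (by positivity) fun n _ ξ hξ ν hν => ?_
  have hξ' := Metric.mem_ball.1 hξ
  have h1 := hball ξ (Metric.mem_ball.2 (hξ'.trans_le (min_le_left _ _))) ν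
    (hν.trans (min_le_left _ _)) (n / L)
  have e : ξ = fun j => (a + (ξ - p)) j + k j * (2 * Real.pi) := by
    ext j
    simp only [hp, Pi.add_apply, Pi.sub_apply]
    ring
  have h2 := hbound (ξ - p) ν (by
    rw [← dist_eq_norm]; exact (hξ'.trans_le (min_le_right _ _)).le) (hν.trans (min_le_right _ _))
  rw [← trigSum_add_period s φ k, ← e] at h2
  rw [norm_mul, norm_pow]
  gcongr

end

/-- Only the threshold for `L` must be uniform over a finite cover; the constants in `GaussianOn`
may depend on `L`. -/
theorem exists_gaussianOn_cube {d : ℕ} {G : ℕ → ℕ → (Fin d → ℝ) → (Fin d → ℝ) → ℂ}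
    {α : Fin d → ℝ} {R : (Fin d → ℝ) → ℝ} (hR : ∀ ξ, 0 ≤ R ξ) {μ : ℝ}
    (h : ∀ p, ∃ S ∈ 𝓝 p, ∃ L₀ : ℕ, ∀ L ≥ L₀, GaussianOn (G L) α R μ S) :
    ∃ L₀ : ℕ, ∀ L ≥ L₀, GaussianOn (G L) α R μ (cube d) := by
  refine (isCompact_cube d).induction_on
    (p := fun S => ∃ L₀ : ℕ, ∀ L ≥ L₀, GaussianOn (G L) α R μ S) ?_ ?_ ?_ ?_
  · exact ⟨0, fun L _ => GaussianOn.empty⟩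
  · rintro S T hST ⟨L₀, h⟩
    exact ⟨L₀, fun L hL => (h L hL).mono hST⟩
  · rintro S T ⟨L₀, h⟩ ⟨L₁, h'⟩
    exact ⟨max L₀ L₁, fun L hL => (h L (le_of_max_le_left hL)).union hR (h' L (le_of_max_le_right hL))⟩
  · intro p _
    obtain ⟨S, hS, h⟩ := h p
    exact ⟨S, mem_nhdsWithin_of_mem_nhds hS, h⟩

/-- Optimising the imaginary shift in a Gaussian-type bound gives the Legendre-Fenchel transform. -/
theorem GaussianOn.exists_norm_coef_le {d : ℕ} {F : ℕ → (Fin d → ℂ) → ℂ}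
    (hF : ∀ n, F n ∈ trigPoly d) {α : Fin d → ℝ} {P : MvPolynomial (Fin d) ℂ}
    (hP : IsPositiveHomogeneous P) {μ : ℝ}
    (h : GaussianOn (fun n ξ ν => F n (cshift ξ ν)) α (rePoly P) μ (cube d)) (Y : ℝ) :
    ∃ C M : ℝ, 0 < C ∧ 0 < M ∧ ∀ n : ℕ, 1 ≤ n → ∀ x : Fin d → ℤ,
      ‖(fun j => ((x j : ℝ) - (n : ℝ) * α j) / (n : ℝ))‖ ≤ Y →
      ‖coef (F n) x‖ ≤ C / (n : ℝ) ^ μ * Real.exp (-((n : ℝ) * M *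
        legendreFenchel (rePoly P) (fun j => ((x j : ℝ) - (n : ℝ) * α j) / (n : ℝ)))) := by
  obtain ⟨ρ, C, M, hρ, hC, hM, hbound⟩ := h
  obtain ⟨lam, hlam, hopt⟩ := hP.exists_le_small_of_legendre (Y := Y) hM hρ
  refine ⟨C, lam, hC, hlam, fun n hn x hx => ?_⟩
  have hn0 : (0 : ℝ) < n := by exact_mod_cast hn
  have hp : (0 : ℝ) < (n : ℝ) ^ μ := Real.rpow_pos_of_pos hn0 _
  set y : Fin d → ℝ := fun j => ((x j : ℝ) - (n : ℝ) * α j) / (n : ℝ) with hy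
  have hall : ∀ ξ : Fin d → ℝ, ‖coef (F n) x‖ ≤
      C / (n : ℝ) ^ μ * Real.exp (-(n * (lam * (y ⬝ᵥ ξ - rePoly P ξ)))) := by
    intro ξ
    obtain ⟨ν, hν, hle⟩ := hopt y hx ξ
    have h1 : ‖coef (F n) x‖ ≤ Real.exp (-((fun j => (x j : ℝ)) ⬝ᵥ ν)) *
        (C / (n : ℝ) ^ μ * Real.exp (n * (α ⬝ᵥ ν + M * rePoly P ν))) := by
      have h2 := (enorm_coef_le (hF n) x ν).trans (mul_le_mul_right (hbound n hn ν hν) _)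
      rw [← ENNReal.ofReal_mul (Real.exp_nonneg _), ← ofReal_norm] at h2
      exact (ENNReal.ofReal_le_ofReal_iff (by positivity)).1 h2
    refine h1.trans ?_
    rw [mul_left_comm, ← Real.exp_add]
    gcongr
    have e : (fun j => (x j : ℝ)) ⬝ᵥ ν = n * (α ⬝ᵥ ν + y ⬝ᵥ ν) := by
      simp only [dotProduct, hy, ← Finset.sum_add_distrib, Finset.mul_sum]
      refine Finset.sum_congr rfl fun j _ => ?_
      field_simp
      ring
    rw [e]
    nlinarith
  -- The bound holds for each `ξ`. Taking logarithms, possible for a nonzero coefficient, turns it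
  -- into an upper bound for `y·ξ - R(ξ)`, and the supremum can be taken.
  rcases (norm_nonneg (coef (F n) x)).eq_or_lt with h0 | h0
  · rw [← h0]; positivity
  have hK : 0 < C / (n : ℝ) ^ μ := by positivity
  set q : ℝ := ‖coef (F n) x‖ / (C / (n : ℝ) ^ μ) with hq
  have hq0 : 0 < q := by positivity
  have hsup : legendreFenchel (rePoly P) y ≤ -Real.log q / (n * lam) := by
    refine ciSup_le fun ξ => ?_
    have h1 := hall ξ
    rw [← div_le_iff₀' hK, ← Real.log_le_iff_le_exp hq0] at h1
    rw [le_div_iff₀ (by positivity)]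
    nlinarith
  rw [le_div_iff₀ (by positivity)] at hsup
  rw [← div_le_iff₀' hK, ← Real.log_le_iff_le_exp hq0]
  nlinarith

end ConvPow

end

/-! ### Assembly of the global bound. -/

theorem theorem1p6 (d : ℕ) (φ : (Fin d → ℤ) → ℂ)
    (hfs : (Function.support φ).Finite) (hnorm : ConvPow.IsNormalized φ)
    (α : (Fin d → ℝ) → (Fin d → ℝ)) (P : (Fin d → ℝ) → MvPolynomial (Fin d) ℂ)
    (μ : (Fin d → ℝ) → ℝ)
    (htype : ∀ ξ ∈ ConvPow.Omega φ, ConvPow.IsPosHomType φ ξ (α ξ) (P ξ))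
    (hμ : ∀ ξ ∈ ConvPow.Omega φ, ConvPow.IsHomogeneousOrder (ConvPow.rePoly (P ξ)) (μ ξ)) :
    (∀ ξ ∈ ConvPow.Omega φ, ∀ x : Fin d → ℝ,
      BddAbove (Set.range fun η : Fin d → ℝ => x ⬝ᵥ η - ConvPow.rePoly (P ξ) η)) ∧
    ∃ hfin : (ConvPow.Omega φ).Finite, ∃ C M : (Fin d → ℝ) → ℝ,
      (∀ ξ ∈ ConvPow.Omega φ, 0 < C ξ ∧ 0 < M ξ) ∧
      ∀ n : ℕ, 1 ≤ n → ∀ x : Fin d → ℤ,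
        ‖ConvPow.convPow φ n x‖ ≤
          ∑ ξ ∈ hfin.toFinset, C ξ / (n : ℝ) ^ μ ξ *
            Real.exp (-((n : ℝ) * M ξ *
              ConvPow.legendreFenchel (ConvPow.rePoly (P ξ))
                (fun j => ((x j : ℝ) - (n : ℝ) * α ξ j) / (n : ℝ)))) := by
  classical
  set s := hfs.toFinset with hsdef
  have hs : Function.support φ ⊆ s := by rw [hsdef, Set.Finite.coe_toFinset]
  refine ⟨fun ξ hξ => (htype ξ hξ).1.bddAbove_legendre, ?_⟩
  have hfin : (ConvPow.Omega φ).Finite :=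
    ConvPow.Omega_finite hs hnorm fun ξ hξ => ⟨α ξ, P ξ, htype ξ hξ⟩
  refine ⟨hfin, ?_⟩
  set t := hfin.toFinset with ht
  have hmem : ∀ a, a ∈ t ↔ a ∈ ConvPow.Omega φ := fun a => hfin.mem_toFinset
  have hle := ConvPow.norm_trigSum_real_le_one hs hnorm
  obtain ⟨W, hWmem, hWsum, hWgrow, A, hA, hWdecay⟩ := ConvPow.exists_weights t
    (fun a ha => ((hmem a).1 ha).1) (by
      obtain ⟨a, ha⟩ := ConvPow.Omega_nonempty hs hnorm
      exact ⟨a, (hmem a).2 ha⟩)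
  have hG : ∀ a ∈ t, ∃ L₀ : ℕ, ∀ L ≥ L₀, ConvPow.GaussianOn (fun n ξ ν =>
      W a (n / L) (ConvPow.cshift ξ ν) * ConvPow.trigSum s φ (ConvPow.cshift ξ ν) ^ n)
      (α a) (ConvPow.rePoly (P a)) (μ a) (ConvPow.cube d) := by
    intro a ha
    have haΩ := (hmem a).1 ha
    have hR := (htype a haΩ).1.nonneg
    refine ConvPow.exists_gaussianOn_cube (G := fun L n ξ ν =>
      W a (n / L) (ConvPow.cshift ξ ν) * ConvPow.trigSum s φ (ConvPow.cshift ξ ν) ^ n) hR fun p => ?_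
    -- Off the translates of `Ω(φ)` the decay of `φ̂^n` wins; at a translate of `a` the local
    -- expansion applies; at a translate of another point the weight of `a` decays.
    rcases (hle p).lt_or_eq with hlt | heq
    · obtain ⟨A', B, hA', hB, hev⟩ := hWgrow p
      exact ConvPow.gaussianOn_of_norm_lt_one hlt hA' hB
        (hev.mono fun x hx => hx a ha) hR _
    · obtain ⟨b, hb, k, rfl⟩ := ConvPow.exists_mem_Omega hs heq
      have hev := hWdecay b ((hmem b).2 hb) k
      by_cases hab : a = b
      · subst hab
        exact ConvPow.gaussianOn_of_isPosHomType hs (htype a haΩ) haΩ.2 (hμ a haΩ) hA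
          (hev.mono fun x hx m => (hx m).1)
      · exact ConvPow.gaussianOn_of_weight_decay hle hA
          (hev.mono fun x hx m => (hx m).2 a ha hab) hR _
  choose! L₀ hL₀ using hG
  -- One `L` serves all points, as the weights sum to one only for a common `m = n / L`.
  set L := t.sup L₀ with hL
  set F : (Fin d → ℝ) → ℕ → (Fin d → ℂ) → ℂ := fun a n => W a (n / L) * ConvPow.trigSum s φ ^ n
    with hFdef
  have hF : ∀ a ∈ t, ∀ n, F a n ∈ ConvPow.trigPoly d := fun a ha n =>
    Subalgebra.mul_mem _ (hWmem a ha _) (Subalgebra.pow_mem _ (ConvPow.trigSum_mem_trigPoly s φ) n)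
  obtain ⟨X, hX, hsupp⟩ := ConvPow.exists_support_convPow hs
  have hbound : ∀ a ∈ t, ∃ C M : ℝ, 0 < C ∧ 0 < M ∧ ∀ n : ℕ, 1 ≤ n → ∀ x : Fin d → ℤ,
      ‖(fun j => ((x j : ℝ) - (n : ℝ) * α a j) / (n : ℝ))‖ ≤ X + ‖α a‖ →
      ‖ConvPow.coef (F a n) x‖ ≤ C / (n : ℝ) ^ μ a * Real.exp (-((n : ℝ) * M *
        ConvPow.legendreFenchel (ConvPow.rePoly (P a))
          (fun j => ((x j : ℝ) - (n : ℝ) * α a j) / (n : ℝ)))) := fun a ha =>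
    ConvPow.GaussianOn.exists_norm_coef_le (hF a ha) (htype a ((hmem a).1 ha)).1
      (hL₀ a ha L (Finset.le_sup ha)) _
  choose! C M hC hM hCM using hbound
  refine ⟨C, M, fun a ha => ⟨hC a ((hmem a).2 ha), hM a ((hmem a).2 ha)⟩, fun n hn x => ?_⟩
  have hn0 : (0 : ℝ) < n := by exact_mod_cast hn
  -- Outside the support the bound is trivial; inside it, `‖x‖ ≤ nX` gives `‖(x - nα)/n‖ ≤ X + ‖α‖`.
  by_cases hx : ConvPow.convPow φ n x = 0
  · rw [hx, norm_zero]
    refine Finset.sum_nonneg fun a ha => ?_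
    have := hC a ha
    have := Real.rpow_pos_of_pos hn0 (μ a)
    positivity
  obtain ⟨m, rfl⟩ : ∃ m, n = m + 1 := ⟨n - 1, by omega⟩
  have hxn := hsupp m x hx
  have hdecomp : ConvPow.trigSum s φ ^ (m + 1) = ∑ a ∈ t, F a (m + 1) := by
    rw [hFdef, ← Finset.sum_mul, hWsum, one_mul]
  rw [← ConvPow.coef_pow_trigSum hs, hdecomp, ConvPow.coef_sum t fun a ha => hF a ha _]
  refine (norm_sum_le _ _).trans (Finset.sum_le_sum fun a ha => hCM a ha (m + 1) hn x ?_)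
  refine (pi_norm_le_iff_of_nonneg (by positivity)).2 fun j => ?_
  have hxj := (norm_le_pi_norm (fun j => (x j : ℝ)) j).trans hxn
  have hαj := norm_le_pi_norm (α a) j
  rw [norm_div, Real.norm_of_nonneg hn0.le, div_le_iff₀ hn0]
  refine (norm_sub_le _ _).trans ?_
  rw [norm_mul, Real.norm_of_nonneg hn0.le]
  push_cast at hn0 ⊢
  nlinarith
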